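/- Let $S$ be a normal algebraic surface over $\mathbb{C}$ (an integral normal separated scheme of finite type over $\mathbb{C}$ of dimension two; projectivity is not needed), let $O$ be a smooth closed point of $S$, let $R$ be an effective Weil divisor on $S$, and let $\mathcal{D}$ be a non-empty linear system on $S$ without fixed components, i.e. $\mathcal{D}=\{\operatorname{div}(f)+B : 0\neq f\in V\}$ for a Weil divisor $B$ and a non-zero complex vector space $V$ of rational functions on $S$ such that $\operatorname{div}(f)+B\geq 0$ for all $0\neq f\in V$, and no prime divisor of $S$ is a component of all members of $\mathcal{D}$. For effective Weil divisors $D$, $D'$ on $S$ with local equations $d$, $d'$ at $O$, let $\operatorname{mult}_O(D)$ be the largest $m$ with $d\in\mathfrak{m}_O^m$, and let $\operatorname{mult}_O(D\cdot D')$ be the length of $\mathcal{O}_{S,O}/(d,d')$. Then, for general members $D_1$ and $D_2$ of $\mathcal{D}$ (that is, for all pairs of members given by pairs $(f_1,f_2)\in V\times V$ at which a certain polynomial function on $V\times V$, not identically zero, does not vanish), the numbers $\operatorname{mult}_O(D_1\cdot R)$ and $\operatorname{mult}_O(D_1\cdot D_2)$ are finite, and $$\operatorname{mult}_O(D_1\cdot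 R)=\operatorname{mult}_O(D_2\cdot R)\leq \operatorname{mult}_O(R)\,\operatorname{mult}_O(D_1\cdot D_2).$$ -/

import Mathlib

open AlgebraicGeometry CategoryTheory

noncomputable section

/-- A normal algebraic surface over `ℂ`: an integral normal scheme of dimension two, separated and
of finite type over `ℂ`. -/
structure NormalSurface where
  /-- the underlying scheme -/
  carrier : Scheme.{0}
  /-- the structure morphism -/
  structureMap : carrier ⟶ Spec (CommRingCat.of ℂ)
  isIntegral : IsIntegral carrier
  isSeparated : IsSeparated structureMap
  locallyOfFiniteType : LocallyOfFiniteType structureMap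
  quasiCompact : QuasiCompact structureMap
  normal : ∀ x : carrier, IsIntegrallyClosed (carrier.presheaf.stalk x)
  dim_eq_two : topologicalKrullDim carrier = 2

namespace NormalSurface

variable (S : NormalSurface)

instance : IsIntegral S.carrier := S.isIntegral

instance : IsLocallyNoetherian S.carrier :=
  haveI := S.locallyOfFiniteType
  LocallyOfFiniteType.isLocallyNoetherian S.structureMap

/-- The field `ℂ(S)` of rational functions on `S`. -/
abbrev RatFun : Type := S.carrier.functionField

/-- The structure morphism makes `ℂ(S)` an algebra over `ℂ`: restrict the pulled back constants
from the global sections to the generic point. -/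
instance : Algebra ℂ S.RatFun :=
  RingHom.toAlgebra <|
    (S.carrier.presheaf.germ ⊤ (genericPoint S.carrier) trivial).hom.comp <|
      (S.structureMap.appTop).hom.comp (Scheme.ΓSpecIso (CommRingCat.of ℂ)).inv.hom

/-- The local ring of `S` at a point. -/
abbrev LocalRingAt (O : S.carrier) : Type := S.carrier.presheaf.stalk O

/-- A smooth point of `S`: a closed point whose local ring is regular. -/
structure IsSmoothPoint (O : S.carrier) : Prop where
  isClosed : IsClosed ({O} : Set S.carrier)
  regular : IsRegularLocalRing (S.LocalRingAt O)

/-- A Weil divisor on `S`: a locally finite integral combination of prime divisors. A prime divisor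
is represented by its generic point, which is a point of codimension one. -/
structure WeilDivisor where
  /-- the underlying cycle; its value at `C` is the coefficient of the closure of `C` -/
  cycle : AlgebraicCycle S.carrier ℤ
  codim_one : ∀ C, cycle C ≠ 0 → Order.coheight C = 1

variable {S}

/-- A Weil divisor is effective if its coefficients are non-negative. -/
def WeilDivisor.IsEffective (D : S.WeilDivisor) : Prop := ∀ C, 0 ≤ D.cycle C

/-- The coefficients of the divisor `div f + D`. -/
def divAdd (f : S.RatFun) (D : S.WeilDivisor) (C : S.carrier) : ℤ :=
  Scheme.ord f C + D.cycle C

/-- The ideal at the point `O` of an effective divisor with coefficients `Z`: it consists of the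
germs that vanish along every prime divisor `C` through `O` to order at least the coefficient of
`C`. (On a normal surface these germs together with `0` already form an ideal, and if `O` is a
smooth point, it is generated by a local equation of the divisor.) -/
def idealAt (O : S.carrier) (Z : S.carrier → ℤ) : Ideal (S.LocalRingAt O) :=
  Ideal.span {g | g ≠ 0 ∧ ∀ C : S.carrier, Order.coheight C = 1 → C ⤳ O →
    Z C ≤ Scheme.ord (algebraMap (S.LocalRingAt O) S.RatFun g) C}

/-- The multiplicity at `O` of an effective divisor with coefficients `Z`: the largest `m` such
that the local equation of the divisor lies in the `m`-th power of the maximal ideal. -/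
def multAt (O : S.carrier) (Z : S.carrier → ℤ) : ℕ∞ :=
  ⨆ m ∈ {m : ℕ | idealAt O Z ≤ IsLocalRing.maximalIdeal (S.LocalRingAt O) ^ m}, (m : ℕ∞)

/-- The local intersection multiplicity at `O` of two effective divisors with coefficients `Z` and
`Z'`: the length of the quotient of the local ring by the local equations of both; it is `⊤` if the
divisors have a common component through `O`. -/
def intersectionMultAt (O : S.carrier) (Z Z' : S.carrier → ℤ) : ℕ∞ :=
  Module.length (S.LocalRingAt O) (S.LocalRingAt O ⧸ (idealAt O Z ⊔ idealAt O Z'))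

variable (S) in
/-- A (non-empty) linear system on `S`: the effective divisors `div f + base`, where `f` runs
through the non-zero elements of a vector space `V` of rational functions all of whose non-zero
elements satisfy `div f + base ≥ 0`. -/
structure LinearSystem where
  base : S.WeilDivisor
  V : Submodule ℂ S.RatFun
  ne_bot : V ≠ ⊥
  effective : ∀ f ∈ V, f ≠ 0 → ∀ C, 0 ≤ divAdd f base C

/-- The coefficients of the member of the linear system given by `f`, meaningful for `f ≠ 0`. -/
def LinearSystem.member (𝒟 : S.LinearSystem) (f : 𝒟.V) : S.carrier → ℤ :=
  divAdd (f : S.RatFun) 𝒟.base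

/-- No prime divisor is a component of all the members of the linear system. -/
def LinearSystem.HasNoFixedComponents (𝒟 : S.LinearSystem) : Prop :=
  ∀ C : S.carrier, Order.coheight C = 1 → ∃ f : 𝒟.V, f ≠ 0 ∧ 𝒟.member f C = 0

end NormalSurface

/-- `P` holds for a general element of the complex vector space `W`: it holds wherever some
polynomial function on `W`, not identically zero, does not vanish. For finite dimensional `W` this
says that `P` holds on a non-empty Zariski open subset. -/
def HoldsGenerally {W : Type*} [AddCommGroup W] [Module ℂ W] (P : W → Prop) : Prop :=
  ∃ F : MvPolynomial (Module.Dual ℂ W) ℂ,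
    (∃ w : W, MvPolynomial.eval (fun φ => φ w) F ≠ 0) ∧
      ∀ w : W, MvPolynomial.eval (fun φ => φ w) F ≠ 0 → P w

/-- A property of a pair of members of a linear system holds for general members `D₁` and `D₂`, if
it holds for general pairs of (non-zero) elements of the vector space defining the system. -/
def NormalSurface.LinearSystem.ForGeneralMembers {S : NormalSurface} (𝒟 : S.LinearSystem)
    (P : (S.carrier → ℤ) → (S.carrier → ℤ) → Prop) : Prop :=
  HoldsGenerally fun f : 𝒟.V × 𝒟.V =>
    f.1 ≠ 0 ∧ f.2 ≠ 0 ∧ P (𝒟.member f.1) (𝒟.member f.2)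

end

/-! Let `A` be the local ring at `O` and `m` its maximal ideal. It is regular of dimension at most
two, so it is factorial. Local equations therefore exist, and those of the members of the system can
be chosen linear in `f`: multiply `f` by one equation of the base divisor. Absence of fixed
components says that the resulting space `V` of germs has no common prime factor. From here on the
problem concerns `V ⊆ A` and an equation `r` of `R` of multiplicity `n`.

Colength of a two-generated ideal is upper semicontinuous (`HoldsGenerally.length_quotient_le`), so
general `d ∈ V` attain the minimum of the length of `A/(d, r)`. This gives the equality, and leaves
the inequality to be proved for one suitable `d ∈ V`.

Let `a, b ∈ V` be a general pair and `l` the colength of `(a, b)`. Then `m ^ l ⊆ (a, b)`. Choose a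
smooth germ of curve `g` transversal to `r`, so that `A/(r, g)` has length at most `n`. The power `g
^ l` lies in the ideal generated by `V` and has colength at most `n * l` in `B = A/(r)`. In the
one-dimensional ring `B`, some `d ∈ V` generates a reduction of any finitely generated part of the
ideal of `V`, and comparing lengths modulo high powers shows that `d` has colength at most that of
`g ^ l` (`Ideal.exists_mem_length_quotient_span_le`). Hence the minimum is at most `n * l`. -/

/-! ### Lengths over local rings and colengths of products -/

open IsLocalRing in
theorem IsLocalRing.length_eq_length_of_residue {k A : Type*} (M : Type*) [Field k] [CommRing A]
    [IsLocalRing A] [Algebra k A] (hres : ∀ a : A, ∃ c : k, a - algebraMap k A c ∈ maximalIdeal A)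
    [AddCommGroup M] [Module A M] [Module k M] [IsScalarTower k A M] :
    Module.length A M = Module.length k M := by
  rw [IsLocalRing.length_restrictScalars k A M]
  have hs : Function.Surjective (algebraMap k (ResidueField A)) := by
    intro z
    obtain ⟨a, rfl⟩ := residue_surjective z
    obtain ⟨c, hc⟩ := hres a
    refine ⟨c, ?_⟩
    rw [← residue_eq_zero_iff, map_sub, sub_eq_zero] at hc
    rw [hc]
    rfl
  have hs' : Function.Surjective (algebraMap (ResidueField k) (ResidueField A)) := by
    intro z
    obtain ⟨c, rfl⟩ := hs z
    exact ⟨residue k c, rfl⟩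
  have : Module.length (ResidueField k) (ResidueField A) = 1 := by
    rw [Module.length_eq_of_surjective (R := ResidueField A) hs']
    exact Module.length_eq_one _ _
  rw [this, mul_one]

theorem Ideal.length_quotient_le_of_le {k A : Type*} [CommRing k] [CommRing A] [Algebra k A]
    {I J : Ideal A} (h : I ≤ J) : Module.length k (A ⧸ J) ≤ Module.length k (A ⧸ I) :=
  Module.length_le_of_surjective (Ideal.Quotient.factorₐ k h).toLinearMap
    (Ideal.Quotient.factor_surjective h)

open IsLocalRing in
-- By Nakayama, multiplying a nonzero module of finite length by the maximal ideal lowers its length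
-- by at least one.
theorem IsLocalRing.maximalIdeal_pow_smul_top_eq_bot {A : Type*} [CommRing A] [IsLocalRing A]
    (l : ℕ) (M : Type*) [AddCommGroup M] [Module A M] (h : Module.length A M ≤ l) :
    (maximalIdeal A) ^ l • (⊤ : Submodule A M) = ⊥ := by
  induction l generalizing M with
  | zero =>
    have : Module.length A M = 0 := by simpa using h
    rw [Module.length_eq_zero_iff] at this
    exact Subsingleton.elim _ _
  | succ l ih =>
    have hfl : IsFiniteLength A M := by
      rw [← Module.length_ne_top_iff]
      exact ne_top_of_le_ne_top (ENat.natCast_ne_top _) h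
    rw [isFiniteLength_iff_isNoetherian_isArtinian] at hfl
    obtain ⟨_, _⟩ := hfl
    cases subsingleton_or_nontrivial M
    · exact Subsingleton.elim _ _
    set N : Submodule A M := maximalIdeal A • ⊤ with hN
    have hNtop : N ≠ ⊤ := fun h ↦ Submodule.top_ne_ideal_smul_of_le_jacobson_annihilator
      (IsLocalRing.maximalIdeal_le_jacobson _) h.symm
    have h1 : Module.length A N ≤ l := by
      have := (Submodule.length_lt hNtop).trans_le h
      exact Order.lt_succ_iff_of_not_isMax (by simp) |>.mp (by simpa using this)
    have h2 := ih N h1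
    have h3 := congrArg (Submodule.map N.subtype) h2
    rw [Submodule.map_smul''] at h3
    simp only [Submodule.map_top, Submodule.range_subtype, Submodule.map_bot] at h3
    rw [pow_succ, Submodule.mul_smul, ← hN, h3]

open IsLocalRing in
theorem IsLocalRing.maximalIdeal_pow_le_of_length_le {A : Type*} [CommRing A] [IsLocalRing A]
    {l : ℕ} {I : Ideal A} (h : Module.length A (A ⧸ I) ≤ l) : maximalIdeal A ^ l ≤ I := by
  have h1 := maximalIdeal_pow_smul_top_eq_bot l (A ⧸ I) h
  intro a ha
  rw [← Ideal.Quotient.eq_zero_iff_mem, ← Submodule.mem_bot A, ← h1]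
  have : Ideal.Quotient.mk I a = a • (1 : A ⧸ I) := by
    rw [Algebra.smul_def, mul_one]; rfl
  rw [this]
  exact Submodule.smul_mem_smul ha trivial

/-- The colength of a sum of a fixed ideal with a principal one is subadditive in products. -/
theorem Ideal.length_quotient_sup_mul_le {k A : Type*} [CommRing k] [CommRing A] [Algebra k A]
    (I : Ideal A) (a b : A) :
    Module.length k (A ⧸ (I ⊔ span {a * b})) ≤
      Module.length k (A ⧸ (I ⊔ span {a})) + Module.length k (A ⧸ (I ⊔ span {b})) := by
  let J := I ⊔ span {a * b}
  have hle : J ≤ I ⊔ span {a} := sup_le_sup_left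
    (by rw [span_singleton_le_span_singleton]; exact dvd_mul_right a b) _
  have hle2 : I ⊔ span {b} ≤ Submodule.comap (LinearMap.mulLeft A a) J := by
    refine sup_le (fun z hz ↦ ?_) ?_
    · exact J.mul_mem_left a (Submodule.mem_sup_left hz)
    · rw [span_singleton_le_iff_mem]
      exact Submodule.mem_sup_right (mem_span_singleton_self _)
  -- The sequence `A/(I, b) → A/(I, ab) → A/(I, a) → 0`, whose first map is multiplication by `a`,
  -- is exact.
  let f : (A ⧸ (I ⊔ span {b})) →ₗ[A] A ⧸ J := Submodule.mapQ _ _ (LinearMap.mulLeft A a) hle2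
  let g : (A ⧸ J) →ₗ[A] A ⧸ (I ⊔ span {a}) := Submodule.factor hle
  let f' := f.restrictScalars k
  let g' := g.restrictScalars k
  have hg : Function.Surjective g' := Submodule.factor_surjective hle
  have hex : LinearMap.ker g' = LinearMap.range f' := by
    apply le_antisymm
    · intro z hz
      obtain ⟨z, rfl⟩ := Ideal.Quotient.mk_surjective z
      have hz' : z ∈ I ⊔ span {a} := by
        rw [← Ideal.Quotient.eq_zero_iff_mem]; exact hz
      obtain ⟨i, hi, w, hw, rfl⟩ := Submodule.mem_sup.mp hz'
      obtain ⟨c, rfl⟩ := mem_span_singleton'.mp hw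
      refine ⟨Ideal.Quotient.mk _ c, ?_⟩
      change Ideal.Quotient.mk J (a * c) = Ideal.Quotient.mk J (i + c * a)
      rw [Ideal.Quotient.eq]
      have : a * c - (i + c * a) = -i := by ring
      rw [this]
      exact J.neg_mem (Submodule.mem_sup_left hi)
    · rintro _ ⟨c, rfl⟩
      obtain ⟨c, rfl⟩ := Ideal.Quotient.mk_surjective c
      change Ideal.Quotient.mk (I ⊔ span {a}) (a * c) = 0
      rw [Ideal.Quotient.eq_zero_iff_mem]
      exact Submodule.mem_sup_right (mul_mem_right _ _ (mem_span_singleton_self _))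
  rw [Module.length_eq_add_of_exact (LinearMap.ker g').subtype g' (Submodule.subtype_injective _)
    hg (LinearMap.exact_subtype_ker_map g'), add_comm]
  gcongr
  rw [hex]
  exact Module.length_le_of_surjective f'.rangeRestrict f'.surjective_rangeRestrict

theorem Ideal.length_quotient_sup_pow_le {k A : Type*} [CommRing k] [CommRing A] [Algebra k A]
    (I : Ideal A) (a : A) (n : ℕ) :
    Module.length k (A ⧸ (I ⊔ span {a ^ n})) ≤ n * Module.length k (A ⧸ (I ⊔ span {a})) := by
  induction n with
  | zero =>
    rw [Module.length_eq_zero_iff.mpr (Ideal.Quotient.subsingleton_iff.mpr (by simp))]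
    exact zero_le
  | succ n ih =>
    rw [pow_succ]
    refine (length_quotient_sup_mul_le I _ a).trans ?_
    push_cast
    rw [add_mul, one_mul]
    gcongr

open scoped Pointwise in
theorem Ideal.length_quotient_span_pow_of_mem_nonZeroDivisors {k A : Type*} [CommRing k]
    [CommRing A] [Algebra k A] {a : A} (ha : a ∈ nonZeroDivisors A) (n : ℕ) :
    Module.length k (A ⧸ span {a ^ n}) = n * Module.length k (A ⧸ span {a}) := by
  induction n with
  | zero =>
    rw [Module.length_eq_zero_iff.mpr (Ideal.Quotient.subsingleton_iff.mpr (by simp))]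
    simp
  | succ n ih =>
    have h1 : Ideal.span {a ^ (n + 1)} = a • Ideal.span {a ^ n} := by
      rw [← Submodule.singleton_set_smul, ← Ideal.submodule_span_eq, Submodule.set_smul_span,
        pow_succ']
      simp
    rw [h1, Module.length_eq_add_of_exact ((mulQuot a (span {a ^ n})).restrictScalars k)
      ((quotOfMul a (span {a ^ n})).restrictScalars k) (mulQuot_injective _ ha)
      (quotOfMul_surjective _) (exact_mulQuot_quotOfMul _), ih]
    push_cast
    ring

/-! ### Reductions of ideals in one-dimensional local rings -/

/-- Every monomial of degree `n + 1` in `a` and `b` other than `b ^ (n + 1)` is divisible by `a`. -/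
theorem Ideal.span_pair_pow_succ_le {B : Type*} [CommRing B] (a b : B) (n : ℕ) :
    span {a, b} ^ (n + 1) ≤ span {a} * span {a, b} ^ n ⊔ span {b ^ (n + 1)} := by
  have hJ : span {a, b} = span {a} ⊔ span {b} := Ideal.span_insert _ _
  have hb : span {b} ≤ span {a, b} := hJ ▸ le_sup_right
  induction n with
  | zero => simp [← hJ]
  | succ n ih =>
    rw [pow_succ' _ (n + 1)]
    refine (Ideal.mul_mono_right ih).trans ?_
    rw [Ideal.mul_sup]
    refine sup_le ?_ ?_
    · refine le_sup_of_le_left ?_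
      rw [mul_left_comm, ← pow_succ']
    · conv_lhs => rw [hJ, Ideal.sup_mul]
      refine sup_le (le_sup_of_le_left (Ideal.mul_mono_right ?_)) (le_sup_of_le_right ?_)
      · rw [← Ideal.span_singleton_pow]
        exact Ideal.pow_right_mono hb _
      · rw [Ideal.span_singleton_mul_span_singleton, ← pow_succ']

theorem Ideal.pow_add_le_of_pow_succ_le {B : Type*} [CommRing B] {J : Ideal B} {a : B} {n : ℕ}
    (h : J ^ (n + 1) ≤ span {a} * J ^ n) (j : ℕ) : J ^ (n + j) ≤ span {a ^ j} * J ^ n := by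
  induction j with
  | zero => simp
  | succ j ih =>
    rw [← add_assoc, pow_succ]
    refine (Ideal.mul_mono_left ih).trans ?_
    rw [mul_assoc, ← pow_succ]
    refine (Ideal.mul_mono_right h).trans ?_
    rw [← mul_assoc, Ideal.span_singleton_mul_span_singleton, pow_succ]

/-- The kernel of multiplication by `a` on `B / aI` contains `I / aI`, so at most `dim B / a`
elements of `I` are linearly independent modulo `aI`. -/
theorem Ideal.exists_relation_mod_mul {k B : Type*} [Field k] [CommRing B] [Algebra k B] {a : B}
    (hfin : Module.Finite k (B ⧸ span {a})) {I : Ideal B}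
    (hI : Module.Finite k (B ⧸ (span {a} * I))) {ι : Type*} [Fintype ι]
    (hcard : Module.finrank k (B ⧸ span {a}) < Fintype.card ι) (v : ι → B) (hv : ∀ i, v i ∈ I) :
    ∃ c : ι → k, (∃ i, c i ≠ 0) ∧ ∑ i, c i • v i ∈ span {a} * I := by
  let E := B ⧸ (span {a} * I)
  let φ : E →ₗ[k] E := LinearMap.mulLeft k (Ideal.Quotient.mk _ a)
  have hmem : ∀ i, Ideal.Quotient.mk (span {a} * I) (v i) ∈ LinearMap.ker φ := by
    intro i
    rw [LinearMap.mem_ker]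
    change Ideal.Quotient.mk _ a * Ideal.Quotient.mk _ (v i) = 0
    rw [← map_mul, Ideal.Quotient.eq_zero_iff_mem]
    exact Ideal.mul_mem_mul (mem_span_singleton_self a) (hv i)
  let q : B →ₗ[k] E ⧸ LinearMap.range φ :=
    (LinearMap.range φ).mkQ.comp (Ideal.Quotient.mkₐ k (span {a} * I)).toLinearMap
  have hq : Function.Surjective q :=
    (Submodule.mkQ_surjective _).comp Ideal.Quotient.mk_surjective
  have hker : (span {a}).restrictScalars k ≤ LinearMap.ker q := by
    intro z hz
    obtain ⟨c, rfl⟩ := mem_span_singleton'.mp hz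
    rw [LinearMap.mem_ker]
    change (LinearMap.range φ).mkQ (Ideal.Quotient.mk _ (c * a)) = 0
    rw [Submodule.mkQ_apply, Submodule.Quotient.mk_eq_zero]
    refine ⟨Ideal.Quotient.mk _ c, ?_⟩
    change Ideal.Quotient.mk _ a * Ideal.Quotient.mk _ c = _
    rw [← map_mul, mul_comm c a]
  let q' : (B ⧸ span {a}) →ₗ[k] E ⧸ LinearMap.range φ :=
    ((span {a}).restrictScalars k).liftQ q hker
  have hq' : Function.Surjective q' := by
    intro z
    obtain ⟨b, rfl⟩ := hq z
    exact ⟨Submodule.Quotient.mk b, rfl⟩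
  have h1 : Module.finrank k (E ⧸ LinearMap.range φ) ≤ Module.finrank k (B ⧸ span {a}) :=
    LinearMap.finrank_le_finrank_of_surjective hq'
  have h2 := LinearMap.finrank_range_add_finrank_ker φ
  have h3 := Submodule.finrank_quotient_add_finrank (LinearMap.range φ)
  -- The kernel and the cokernel of an endomorphism of a finite-dimensional space have equal
  -- dimension, and the cokernel is a quotient of `B/a`.
  have h4 : Module.finrank k (LinearMap.ker φ) < Fintype.card ι := by omega
  let w : ι → LinearMap.ker φ := fun i ↦ ⟨_, hmem i⟩
  have h5 : ¬ LinearIndependent k w := fun h ↦ absurd h.fintype_card_le_finrank (by omega)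
  obtain ⟨c, hc, i, hi⟩ := Fintype.not_linearIndependent_iff.mp h5
  refine ⟨c, ⟨i, hi⟩, ?_⟩
  rw [← Ideal.Quotient.eq_zero_iff_mem]
  have := congrArg (Submodule.subtype _) hc
  simp only [map_sum, map_smul, map_zero] at this
  rw [← this, map_sum]
  rfl

theorem Polynomial.exists_sum_mul_pow_ne_zero {k : Type*} [Field k] [Infinite k] {n : ℕ}
    {c : Fin n → k} (hc : ∃ i, c i ≠ 0) : ∃ s : k, ∑ i, c i * s ^ (i : ℕ) ≠ 0 := by
  obtain ⟨i, hi⟩ := hc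
  by_contra! h
  have : (∑ i : Fin n, Polynomial.C (c i) * Polynomial.X ^ (i : ℕ)) = 0 := by
    refine Polynomial.funext fun s ↦ ?_
    simpa [Polynomial.eval_finsetSum] using h s
  have h2 := congrArg (fun p ↦ Polynomial.coeff p i) this
  simp only [Polynomial.finsetSum_coeff, Polynomial.coeff_C_mul, Polynomial.coeff_X_pow,
    Polynomial.coeff_zero] at h2
  rw [Finset.sum_eq_single i] at h2
  · simp [hi] at h2
  · intro j _ hj
    rw [if_neg (fun h ↦ hj (Fin.ext h.symm)), mul_zero]
  · simp

/-- Modulo `a - s • b` one may replace `a` by `s • b`; the point is that the error keeps its degree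
and lies in `(a - s • b)` times the `N`-th power, as a reduction requires. -/
theorem Ideal.mul_pow_sub_mem_span_mul {k B : Type*} [Field k] [CommRing B] [Algebra k B]
    (a b : B) (s : k) (N : ℕ) (i j : ℕ) (hij : i + j = N + 1) :
    a ^ i * b ^ j - s ^ i • b ^ (N + 1) ∈ span {a - s • b} * span {a, b} ^ N := by
  have ha : a ∈ span {a, b} := subset_span (by simp)
  have hb : b ∈ span {a, b} := subset_span (by simp)
  induction i generalizing j with
  | zero =>
    obtain rfl : j = N + 1 := by omega
    simp
  | succ i ih =>
    have h1 := ih (j + 1) (by omega)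
    have h2 : a ^ (i + 1) * b ^ j - s ^ (i + 1) • b ^ (N + 1) =
        (a - s • b) * (a ^ i * b ^ j) + s • (a ^ i * b ^ (j + 1) - s ^ i • b ^ (N + 1)) := by
      simp only [Algebra.smul_def, map_pow]
      ring
    rw [h2]
    refine add_mem (Ideal.mul_mem_mul (mem_span_singleton_self _) ?_)
      (Submodule.smul_of_tower_mem _ s h1)
    obtain rfl : N = i + j := by omega
    rw [pow_add]
    exact Ideal.mul_mem_mul (Ideal.pow_mem_pow ha _) (Ideal.pow_mem_pow hb _)

theorem Ideal.finite_quotient_of_le {k B : Type*} [Field k] [CommRing B] [Algebra k B]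
    {I J : Ideal B} (h : I ≤ J) (hI : Module.Finite k (B ⧸ I)) : Module.Finite k (B ⧸ J) :=
  Module.Finite.of_surjective (Ideal.Quotient.factorₐ k h).toLinearMap
    (Ideal.Quotient.factor_surjective h)

theorem Module.finite_iff_length_ne_top {k M : Type*} [Field k] [AddCommGroup M] [Module k M] :
    Module.Finite k M ↔ Module.length k M ≠ ⊤ := by
  rw [Module.length_ne_top_iff, isFiniteLength_iff_isNoetherian_isArtinian]
  refine ⟨fun h ↦ ⟨inferInstance, inferInstance⟩, fun h ↦ ?_⟩
  obtain ⟨_, _⟩ := h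
  infer_instance

theorem Ideal.finite_quotient_span_pow {k B : Type*} [Field k] [CommRing B] [Algebra k B] {a : B}
    (h : Module.Finite k (B ⧸ span {a})) (n : ℕ) : Module.Finite k (B ⧸ span {a ^ n}) := by
  rw [Module.finite_iff_length_ne_top] at h ⊢
  have := Ideal.length_quotient_sup_pow_le (k := k) (⊥ : Ideal B) a n
  rw [bot_sup_eq, bot_sup_eq] at this
  exact ne_top_of_le_ne_top (WithTop.mul_ne_top (ENat.natCast_ne_top n) h) this

open IsLocalRing in
/-- In a local ring of dimension one, a general linear combination of two elements generates a
reduction of the ideal they generate. -/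
theorem Ideal.exists_pair_pow_le {k B : Type*} [Field k] [Infinite k] [CommRing B] [IsLocalRing B]
    [Algebra k B] {a : B} (hfin : Module.Finite k (B ⧸ span {a})) (b : B) :
    ∃ (s : k) (n : ℕ), ∀ j, span {a, b} ^ (n + j) ≤ span {(a - s • b) ^ j} := by
  by_cases ha : IsUnit a
  · refine ⟨0, 0, fun j ↦ ?_⟩
    rw [zero_smul, sub_zero, Ideal.span_singleton_eq_top.mpr (ha.pow j)]
    exact le_top
  have ham : span {a} ≤ maximalIdeal B := by
    rw [span_singleton_le_iff_mem]; exact ha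
  set J : Ideal B := span {a, b} with hJ
  obtain ⟨N, hN⟩ : ∃ N, Module.finrank k (B ⧸ span {a}) = N := ⟨_, rfl⟩
  have haJ : a ∈ J := subset_span (by simp)
  have hbJ : b ∈ J := subset_span (by simp)
  have hI : Module.Finite k (B ⧸ (span {a} * J ^ (N + 1))) := by
    refine finite_quotient_of_le ?_ (finite_quotient_span_pow hfin (N + 2))
    rw [span_singleton_le_iff_mem, pow_succ' a]
    exact Ideal.mul_mem_mul (mem_span_singleton_self a) (Ideal.pow_mem_pow haJ _)
  have hv (i : Fin (N + 2)) : a ^ (i : ℕ) * b ^ (N + 1 - (i : ℕ)) ∈ J ^ (N + 1) := by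
    have h1 := Ideal.mul_mem_mul (Ideal.pow_mem_pow haJ (i : ℕ))
      (Ideal.pow_mem_pow hbJ (N + 1 - (i : ℕ)))
    have h2 : (i : ℕ) + (N + 1 - (i : ℕ)) = N + 1 := by omega
    rwa [← pow_add, h2] at h1
  -- There are `N + 2` monomials of degree `N + 1`, more than the `N` dimensions available in `J ^
  -- (N + 1)` modulo `a J ^ (N + 1)`, so they satisfy a relation there with constant coefficients
  -- `c`.
  have hcard : Module.finrank k (B ⧸ span {a}) < Fintype.card (Fin (N + 2)) := by
    rw [hN, Fintype.card_fin]; omega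
  obtain ⟨c, hc, hmem⟩ := exists_relation_mod_mul hfin hI hcard _ hv
  obtain ⟨s, hs⟩ := Polynomial.exists_sum_mul_pow_ne_zero hc
  refine ⟨s, N, fun j ↦ ?_⟩
  set d := a - s • b with hd
  have hJd : J = span {d, b} := by
    apply le_antisymm
    · rw [hJ, span_le]
      rintro z (rfl | rfl)
      · have : z = d + s • b := by rw [hd]; ring
        rw [this]
        exact add_mem (subset_span (by simp))
          (Submodule.smul_of_tower_mem _ s (subset_span (by simp)))
      · exact subset_span (by simp)
    · rw [span_le]
      rintro z (rfl | rfl)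
      · exact sub_mem haJ (Submodule.smul_of_tower_mem _ s hbJ)
      · exact hbJ
  -- Modulo `d J ^ N` the relation becomes `(∑ c i * s ^ i) • b ^ (N + 1)`. Its scalar is nonzero by
  -- the choice of `s`, and the relation lies in `m J ^ (N + 1)` because `a` is not a unit. Nakayama
  -- then removes the second summand.
  have hb1 : b ^ (N + 1) ∈ span {d} * J ^ N ⊔ maximalIdeal B * J ^ (N + 1) := by
    have h1 : ∑ i : Fin (N + 2), c i • (a ^ (i : ℕ) * b ^ (N + 1 - i) - s ^ (i : ℕ) • b ^ (N + 1))
        ∈ span {d} * J ^ N :=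
      Submodule.sum_mem _ fun i _ ↦ Submodule.smul_of_tower_mem _ (c i)
        (mul_pow_sub_mem_span_mul a b s N i (N + 1 - i) (by omega))
    have h2 := sub_mem (Submodule.mem_sup_right
      (Ideal.mul_mono_left ham hmem) : _ ∈ span {d} * J ^ N ⊔ maximalIdeal B * J ^ (N + 1))
      (Submodule.mem_sup_left h1)
    have h3 : ∑ i : Fin (N + 2), c i • (a ^ (i : ℕ) * b ^ (N + 1 - i)) -
        ∑ i : Fin (N + 2), c i • (a ^ (i : ℕ) * b ^ (N + 1 - i) - s ^ (i : ℕ) • b ^ (N + 1)) =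
        (∑ i, c i * s ^ (i : ℕ)) • b ^ (N + 1) := by
      rw [← Finset.sum_sub_distrib, Finset.sum_smul]
      refine Finset.sum_congr rfl fun i _ ↦ ?_
      rw [smul_sub, sub_sub_cancel, smul_smul]
    rw [h3] at h2
    have h4 := Submodule.smul_of_tower_mem _ (∑ i, c i * s ^ (i : ℕ))⁻¹ h2
    rwa [smul_smul, inv_mul_cancel₀ hs, one_smul] at h4
  have hfg : (J ^ (N + 1)).FG := Ideal.FG.pow (Submodule.fg_span (by simp))
  have hred : J ^ (N + 1) ≤ span {d} * J ^ N := by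
    refine Submodule.le_of_le_smul_of_le_jacobson_bot hfg
      (IsLocalRing.maximalIdeal_le_jacobson _) ?_
    have := span_pair_pow_succ_le d b N
    rw [← hJd] at this
    refine this.trans (sup_le le_sup_left ?_)
    rw [span_singleton_le_iff_mem]
    exact hb1
  exact (pow_add_le_of_pow_succ_le hred j).trans Ideal.mul_le_left

/-- Expand binomially: a factor `I ^ i` costs at most `n` degrees when replaced by a power of `a`.
-/
theorem Ideal.sup_span_pow_le {B : Type*} [CommRing B] {I : Ideal B} {a b : B} {n : ℕ}
    (h : ∀ j, I ^ (n + j) ≤ span {a ^ j}) (M : ℕ) :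
    (I ⊔ span {b}) ^ (n + M) ≤ span {a, b} ^ M := by
  have hab : span {a, b} = span {a} ⊔ span {b} := Ideal.span_insert _ _
  have ha : span {a} ≤ span {a, b} := hab ▸ le_sup_left
  have hb : span {b} ≤ span {a, b} := hab ▸ le_sup_right
  rw [← Ideal.add_eq_sup, add_pow, Ideal.sum_eq_sup]
  refine Finset.sup_le fun i hi ↦ Ideal.mul_le_left.trans ?_
  have hi' : i ≤ n + M := by simpa [Nat.lt_succ_iff] using hi
  rcases le_total n i with hni | hni
  · obtain ⟨j, rfl⟩ := Nat.exists_eq_add_of_le hni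
    refine (Ideal.mul_mono (h j) le_rfl).trans ?_
    rw [← Ideal.span_singleton_pow]
    refine (Ideal.mul_mono (Ideal.pow_right_mono ha _) (Ideal.pow_right_mono hb _)).trans ?_
    rw [← pow_add]
    exact Ideal.pow_le_pow_right (by omega)
  · refine Ideal.mul_le_right.trans ((Ideal.pow_right_mono hb _).trans ?_)
    exact Ideal.pow_le_pow_right (by omega)

/-- Generators are absorbed one at a time: `d` is replaced by `d - s • b`, which divides a power of
`d` and so remains a nonzerodivisor of finite colength. -/
theorem Ideal.exists_mem_pow_le {k B : Type*} [Field k] [Infinite k] [CommRing B] [IsLocalRing B]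
    [Algebra k B] {V : Submodule k B} {a : B} (ha : a ∈ V) (hnz : a ∈ nonZeroDivisors B)
    (hfin : Module.Finite k (B ⧸ span {a})) (T : Finset B) (hT : (T : Set B) ⊆ V) :
    ∃ d ∈ V, d ∈ nonZeroDivisors B ∧ Module.Finite k (B ⧸ span {d}) ∧
      ∃ n, ∀ j, span (T : Set B) ^ (n + j) ≤ span {d ^ j} := by
  classical
  induction T using Finset.induction_on with
  | empty =>
    refine ⟨a, ha, hnz, hfin, 1, fun j ↦ ?_⟩
    rw [add_comm, pow_succ]
    simp
  | insert b T _ ih =>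
    obtain ⟨d, hdV, hd, hdfin, n, hn⟩ := ih fun z hz ↦ hT (by simp [hz])
    obtain ⟨s, m, hm⟩ := exists_pair_pow_le hdfin b
    have hdvd : d ^ (m + 1) ∈ span {d - s • b} := by
      rw [← pow_one (d - s • b)]
      exact hm 1 (Ideal.pow_mem_pow (subset_span (by simp)) _)
    refine ⟨d - s • b, V.sub_mem hdV (V.smul_mem s (hT (by simp))), ?_, ?_, n + m, fun j ↦ ?_⟩
    · obtain ⟨c, hc⟩ := mem_span_singleton'.mp hdvd
      have := pow_mem hd (m + 1)
      rw [← hc] at this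
      exact (mul_mem_nonZeroDivisors.mp this).2
    · refine finite_quotient_of_le ?_ (finite_quotient_span_pow hdfin (m + 1))
      rwa [span_singleton_le_iff_mem]
    · rw [Finset.coe_insert, Ideal.span_insert, sup_comm, add_assoc]
      exact (sup_span_pow_le hn _).trans (hm j)

/-- Since `h ^ (n + j) ∈ (d ^ j)`, the colengths satisfy `j * ℓ(d) ≤ (n + j) * ℓ(h)` for all `j`,
and the fixed shift `n` is negligible for large `j`. -/
theorem Ideal.length_quotient_span_le_of_pow_le {k B : Type*} [Field k] [CommRing B]
    [Algebra k B] {I : Ideal B} {d h : B} {n : ℕ} (hd : d ∈ nonZeroDivisors B)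
    (hI : ∀ j, I ^ (n + j) ≤ span {d ^ j}) (hh : h ∈ I) :
    Module.length k (B ⧸ span {d}) ≤ Module.length k (B ⧸ span {h}) := by
  by_contra! hlt
  obtain ⟨b, hb⟩ := ENat.ne_top_iff_exists.mp hlt.ne_top
  have key (j : ℕ) : j * Module.length k (B ⧸ span {d}) ≤
      (n + j : ℕ) * Module.length k (B ⧸ span {h}) := by
    rw [← length_quotient_span_pow_of_mem_nonZeroDivisors hd]
    have := Ideal.length_quotient_sup_pow_le (k := k) (⊥ : Ideal B) h (n + j)
    rw [bot_sup_eq, bot_sup_eq] at this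
    refine (length_quotient_le_of_le ?_).trans this
    rw [span_singleton_le_iff_mem]
    exact hI j (Ideal.pow_mem_pow hh _)
  -- If `ℓ(d) ≥ b + 1` and `ℓ(h) = b`, the inequality for `j` forces `j ≤ n * b`.
  have h1 := key (n * b + 1)
  have h2 : ((b + 1 : ℕ) : ℕ∞) ≤ Module.length k (B ⧸ span {d}) := by
    rw [← hb] at hlt
    push_cast
    exact Order.add_one_le_of_lt hlt
  rw [← hb] at h1
  have h3 : ((n * b + 1 : ℕ) : ℕ∞) * ((b + 1 : ℕ) : ℕ∞) ≤ ((n + (n * b + 1) : ℕ) : ℕ∞) * b :=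
    (mul_le_mul_right h2 _).trans h1
  have h4 : (n * b + 1) * (b + 1) ≤ (n + (n * b + 1)) * b := by exact_mod_cast h3
  nlinarith

/-- In a local ring of dimension one, the least colength of an element of an ideal is attained in
every vector space of generators of the ideal. -/
theorem Ideal.exists_mem_length_quotient_span_le {k B : Type*} [Field k] [Infinite k] [CommRing B]
    [IsLocalRing B] [Algebra k B] {V : Submodule k B} {a : B} (ha : a ∈ V)
    (hnz : a ∈ nonZeroDivisors B) (hfin : Module.Finite k (B ⧸ span {a})) {h : B}
    (hh : h ∈ span (V : Set B)) :
    ∃ d ∈ V, Module.length k (B ⧸ span {d}) ≤ Module.length k (B ⧸ span {h}) := by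
  obtain ⟨T, hT, hhT⟩ := Submodule.mem_span_finite_of_mem_span hh
  obtain ⟨d, hdV, hd, -, n, hn⟩ := exists_mem_pow_le ha hnz hfin T hT
  exact ⟨d, hdV, length_quotient_span_le_of_pow_le hd hn hhT⟩

/-! ### General elements of a vector space and semicontinuity -/

theorem HoldsGenerally.mono {W : Type*} [AddCommGroup W] [Module ℂ W] {P Q : W → Prop}
    (h : HoldsGenerally P) (hPQ : ∀ w, P w → Q w) : HoldsGenerally Q := by
  obtain ⟨F, hF, hP⟩ := h
  exact ⟨F, hF, fun w hw ↦ hPQ w (hP w hw)⟩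

/-- The restriction of a polynomial function to a line is a polynomial function. -/
theorem MvPolynomial.exists_polynomial_eval_line {W : Type*} [AddCommGroup W] [Module ℂ W]
    (F : MvPolynomial (Module.Dual ℂ W) ℂ) (v w : W) :
    ∃ p : Polynomial ℂ, ∀ c : ℂ, p.eval c = eval (fun φ ↦ φ (v + c • w)) F := by
  refine ⟨aeval (fun φ : Module.Dual ℂ W ↦
    Polynomial.C (φ v) + Polynomial.X * Polynomial.C (φ w)) F, fun c ↦ ?_⟩
  induction F using MvPolynomial.induction_on with
  | C a => simp
  | add p q hp hq => simp only [map_add, Polynomial.eval_add, hp, hq]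
  | mul_X p φ hp =>
    simp only [map_mul, Polynomial.eval_mul, hp, aeval_X, eval_X, map_add, map_smul,
      Polynomial.eval_add, Polynomial.eval_C, Polynomial.eval_X, smul_eq_mul]

/-- On the line joining a point where `F` is nonzero to one where `G` is nonzero, both restrict to
nonzero polynomials in one variable, so their product is not identically zero. No finiteness of `W`
is needed. -/
theorem HoldsGenerally.and {W : Type*} [AddCommGroup W] [Module ℂ W] {P Q : W → Prop}
    (hP : HoldsGenerally P) (hQ : HoldsGenerally Q) : HoldsGenerally fun w ↦ P w ∧ Q w := by
  obtain ⟨F, ⟨v, hv⟩, hF⟩ := hP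
  obtain ⟨G, ⟨w, hw⟩, hG⟩ := hQ
  refine ⟨F * G, ?_, fun u hu ↦ ?_⟩
  · obtain ⟨p, hp⟩ := MvPolynomial.exists_polynomial_eval_line F v (w - v)
    obtain ⟨q, hq⟩ := MvPolynomial.exists_polynomial_eval_line G v (w - v)
    have hp0 : p ≠ 0 := by
      rintro rfl
      exact hv (by simpa using (hp 0).symm)
    have hq0 : q ≠ 0 := by
      rintro rfl
      exact hw (by simpa using (hq 1).symm)
    by_contra! h
    refine mul_ne_zero hp0 hq0 (Polynomial.funext fun c ↦ ?_)
    rw [Polynomial.eval_mul, hp, hq, ← map_mul, h, Polynomial.eval_zero]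
  · rw [map_mul] at hu
    exact ⟨hF u (left_ne_zero_of_mul hu), hG u (right_ne_zero_of_mul hu)⟩

theorem HoldsGenerally.ne_zero {W A : Type*} [AddCommGroup W] [Module ℂ W] [AddCommGroup A]
    [Module ℂ A] (s : W →ₗ[ℂ] A) {w₀ : W} (h : s w₀ ≠ 0) : HoldsGenerally fun w ↦ s w ≠ 0 := by
  obtain ⟨φ, hφ⟩ : ∃ φ : Module.Dual ℂ A, φ (s w₀) ≠ 0 := by
    by_contra! h'
    exact h ((Module.forall_dual_apply_eq_zero_iff ℂ _).mp h')
  refine ⟨MvPolynomial.X (φ.comp s), ⟨w₀, by simpa using hφ⟩, fun w hw h0 ↦ hw ?_⟩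
  simp [h0]

theorem LinearMap.exists_comp_comp_eq_id {k M N : Type*} [Field k] [AddCommGroup M] [Module k M]
    [AddCommGroup N] [Module k N] [Module.Finite k N] (U : M →ₗ[k] N) :
    ∃ (i : (Fin (Module.finrank k (range U)) → k) →ₗ[k] M)
      (p : N →ₗ[k] (Fin (Module.finrank k (range U)) → k)), p ∘ₗ U ∘ₗ i = LinearMap.id := by
  let b := Module.finBasis k (range U)
  obtain ⟨j, hj⟩ := U.rangeRestrict.exists_rightInverse_of_surjective U.range_rangeRestrict
  obtain ⟨q, hq⟩ := (range U).subtype.exists_leftInverse_of_injective (Submodule.ker_subtype _)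
  refine ⟨j ∘ₗ b.equivFun.symm, b.equivFun.toLinearMap ∘ₗ q, ?_⟩
  refine LinearMap.ext fun x ↦ ?_
  have h1 : U (j (b.equivFun.symm x)) = (range U).subtype (b.equivFun.symm x) := by
    have := congrArg Subtype.val (LinearMap.congr_fun hj (b.equivFun.symm x))
    exact this
  have h2 := LinearMap.congr_fun hq (b.equivFun.symm x)
  change b.equivFun (q (U (j (b.equivFun.symm x)))) = x
  rw [h1]
  simp only [LinearMap.comp_apply, LinearMap.id_apply] at h2
  rw [h2, LinearEquiv.apply_symm_apply]

/-- The rank is lower semicontinuous in affine families of linear maps. -/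
theorem HoldsGenerally.finrank_range_le {W M N : Type*} [AddCommGroup W] [Module ℂ W]
    [AddCommGroup M] [Module ℂ M] [AddCommGroup N] [Module ℂ N] [Module.Finite ℂ N]
    (T : W →ₗ[ℂ] M →ₗ[ℂ] N) (T₀ : M →ₗ[ℂ] N) (w₀ : W) :
    HoldsGenerally fun w ↦ Module.finrank ℂ (LinearMap.range (T w₀ + T₀)) ≤
      Module.finrank ℂ (LinearMap.range (T w + T₀)) := by
  obtain ⟨i, p, hip⟩ := LinearMap.exists_comp_comp_eq_id (T w₀ + T₀)
  generalize Module.finrank ℂ (LinearMap.range (T w₀ + T₀)) = n at i p hip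
  let φ (a b : Fin n) : Module.Dual ℂ W :=
    LinearMap.proj a ∘ₗ p ∘ₗ LinearMap.applyₗ (i (Pi.single b 1)) ∘ₗ T
  -- An `n × n` minor of `T w + T₀`, in bases for which it equals one at `w₀`; where it does not
  -- vanish, the rank is at least `n`.
  let F : MvPolynomial (Module.Dual ℂ W) ℂ := Matrix.det (Matrix.of fun a b ↦
    MvPolynomial.X (φ a b) + MvPolynomial.C (p (T₀ (i (Pi.single b 1))) a))
  have hF (w : W) : MvPolynomial.eval (fun φ ↦ φ w) F =
      LinearMap.det (p ∘ₗ (T w + T₀) ∘ₗ i) := by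
    rw [← LinearMap.det_toMatrix', RingHom.map_det]
    congr 1
    ext a b
    simp [φ, LinearMap.toMatrix'_apply]
  refine ⟨F, ⟨w₀, ?_⟩, fun w hw ↦ ?_⟩
  · rw [hF, hip, LinearMap.det_id]
    exact one_ne_zero
  · rw [hF] at hw
    have h1 : LinearMap.range (p ∘ₗ (T w + T₀) ∘ₗ i) = ⊤ :=
      LinearMap.range_eq_top.mpr (LinearMap.equivOfDetNeZero _ hw).surjective
    have h2 : Module.finrank ℂ (LinearMap.range (p ∘ₗ (T w + T₀) ∘ₗ i)) = n := by
      rw [h1, finrank_top, Module.finrank_fin_fun]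
    rw [← h2, LinearMap.range_comp]
    refine (Submodule.finrank_map_le _ _).trans (Submodule.finrank_mono ?_)
    exact LinearMap.range_comp_le_range _ _

open IsLocalRing in
theorem IsLocalRing.length_quotient_ne_top {A : Type*} [CommRing A] [IsLocalRing A]
    [IsNoetherianRing A] {I : Ideal A} (h : ∀ p : Ideal A, p.IsPrime → I ≤ p → p = maximalIdeal A) :
    Module.length A (A ⧸ I) ≠ ⊤ := by
  have h0 : Ring.KrullDimLE 0 (A ⧸ I) := by
    refine Ring.krullDimLE_zero_iff.mpr fun p hp ↦ ?_
    have h1 := h (p.comap (Ideal.Quotient.mk I)) inferInstance (by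
      intro a ha
      rw [Ideal.mem_comap, Ideal.Quotient.eq_zero_iff_mem.mpr ha]
      exact p.zero_mem)
    exact Ideal.isMaximal_of_isIntegral_of_isMaximal_comap p
      (h1 ▸ IsLocalRing.maximalIdeal.isMaximal A)
  have := IsNoetherianRing.isArtinianRing_of_krullDimLE_zero (R := A ⧸ I)
  rw [Module.length_eq_of_surjective (R := A ⧸ I) Ideal.Quotient.mk_surjective]
  exact Module.length_ne_top

open IsLocalRing in
theorem IsLocalRing.length_quotient_maximalIdeal_pow_ne_top {A : Type*} [CommRing A]
    [IsLocalRing A] [IsNoetherianRing A] (n : ℕ) :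
    Module.length A (A ⧸ maximalIdeal A ^ n) ≠ ⊤ :=
  length_quotient_ne_top fun _ hp h ↦
    ((IsLocalRing.maximalIdeal.isMaximal A).eq_of_le hp.ne_top (hp.le_of_pow_le h)).symm

/-- The image of `(y, w) ↦ a * y + b * w` in `A/K` is `((a, b) + K)/K`, so colength becomes corank
of a map linear in `a` and `b`. -/
theorem Ideal.length_quotient_add_finrank_range {k A : Type*} [Field k] [CommRing A] [Algebra k A]
    (K : Ideal A) [Module.Finite k (A ⧸ K)] (a b : A) :
    Module.finrank k (A ⧸ (span {a} ⊔ span {b} ⊔ K)) + Module.finrank k (LinearMap.range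
      ((LinearMap.mul k (A ⧸ K) (Ideal.Quotient.mk K a)).coprod
        (LinearMap.mul k (A ⧸ K) (Ideal.Quotient.mk K b)))) = Module.finrank k (A ⧸ K) := by
  set U := (LinearMap.mul k (A ⧸ K) (Ideal.Quotient.mk K a)).coprod
    (LinearMap.mul k (A ⧸ K) (Ideal.Quotient.mk K b)) with hU
  rw [← Submodule.finrank_quotient_add_finrank (LinearMap.range U)]
  congr 1
  have hUapp (y w : A) : U (Ideal.Quotient.mk K y, Ideal.Quotient.mk K w) =
      Ideal.Quotient.mk K (a * y + b * w) := by
    rw [map_add, map_mul, map_mul]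
    rfl
  clear_value U
  let f : A →ₗ[k] (A ⧸ K) ⧸ LinearMap.range U :=
    (LinearMap.range U).mkQ ∘ₗ (Ideal.Quotient.mkₐ k K).toLinearMap
  let g : A →ₗ[k] A ⧸ (span {a} ⊔ span {b} ⊔ K) := (Ideal.Quotient.mkₐ k _).toLinearMap
  have hf : Function.Surjective f :=
    (Submodule.mkQ_surjective _).comp Ideal.Quotient.mk_surjective
  have hg : Function.Surjective g := Ideal.Quotient.mk_surjective
  have hker : LinearMap.ker g = LinearMap.ker f := by
    ext z
    have h1 : z ∈ LinearMap.ker g ↔ z ∈ span {a} ⊔ span {b} ⊔ K := Ideal.Quotient.eq_zero_iff_mem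
    have h2 : z ∈ LinearMap.ker f ↔ Ideal.Quotient.mk K z ∈ LinearMap.range U := by
      rw [LinearMap.mem_ker]
      exact Submodule.Quotient.mk_eq_zero _
    rw [h1, h2]
    constructor
    · intro hz
      obtain ⟨y, hy, c, hc, rfl⟩ := Submodule.mem_sup.mp hz
      rw [← Ideal.span_insert] at hy
      obtain ⟨y, w, rfl⟩ := Ideal.mem_span_pair.mp hy
      refine ⟨(Ideal.Quotient.mk K y, Ideal.Quotient.mk K w), ?_⟩
      rw [hUapp, map_add _ _ c, Ideal.Quotient.eq_zero_iff_mem.mpr hc, add_zero, mul_comm a,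
        mul_comm b]
    · rintro ⟨⟨y, w⟩, hyw⟩
      obtain ⟨y, rfl⟩ := Ideal.Quotient.mk_surjective y
      obtain ⟨w, rfl⟩ := Ideal.Quotient.mk_surjective w
      have h3 : Ideal.Quotient.mk K (a * y + b * w) = Ideal.Quotient.mk K z := by
        rw [← hyw, hUapp]
      rw [Ideal.Quotient.eq] at h3
      have h4 : z = a * y + b * w - (a * y + b * w - z) := by ring
      rw [h4]
      refine sub_mem (Submodule.mem_sup_left (add_mem ?_ ?_)) (Submodule.mem_sup_right h3)
      · exact Submodule.mem_sup_left (mul_mem_right _ _ (mem_span_singleton_self _))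
      · exact Submodule.mem_sup_right (mul_mem_right _ _ (mem_span_singleton_self _))
  exact ((g.quotKerEquivOfSurjective hg).symm ≪≫ₗ Submodule.quotEquivOfEq _ _ hker ≪≫ₗ
    f.quotKerEquivOfSurjective hf).finrank_eq

open IsLocalRing in
/-- The colength of the ideal generated by two elements is upper semicontinuous. -/
theorem HoldsGenerally.length_quotient_le {A W : Type*} [CommRing A] [IsLocalRing A]
    [IsNoetherianRing A] [Algebra ℂ A] (hres : ∀ a : A, ∃ c : ℂ, a - algebraMap ℂ A c ∈ maximalIdeal A)
    [AddCommGroup W] [Module ℂ W] (s t : W →ₗ[ℂ] A) (r : A) (w₀ : W) {l : ℕ}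
    (hl : Module.length A (A ⧸ (Ideal.span {s w₀} ⊔ Ideal.span {t w₀ + r})) ≤ l) :
    HoldsGenerally fun w ↦
      Module.length A (A ⧸ (Ideal.span {s w} ⊔ Ideal.span {t w + r})) ≤ l := by
  -- Truncation makes everything finite-dimensional. The exponent `l + 1` loses nothing: colength at
  -- most `l` modulo `K` gives `m ^ l ⊆ (s w, t w + r) + m ^ (l + 1)`, whence `m ^ l ⊆ (s w, t w +
  -- r)` by Nakayama.
  obtain ⟨K, hK⟩ : ∃ K, K = maximalIdeal A ^ (l + 1) := ⟨_, rfl⟩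
  have hfin : Module.Finite ℂ (A ⧸ K) := by
    rw [Module.finite_iff_length_ne_top, ← length_eq_length_of_residue _ hres]
    exact hK ▸ length_quotient_maximalIdeal_pow_ne_top _
  let μ : A →ₗ[ℂ] (A ⧸ K) →ₗ[ℂ] (A ⧸ K) :=
    LinearMap.mul ℂ (A ⧸ K) ∘ₗ (Ideal.Quotient.mkₐ ℂ K).toLinearMap
  let T : W →ₗ[ℂ] ((A ⧸ K) × (A ⧸ K)) →ₗ[ℂ] (A ⧸ K) :=
    LinearMap.lcomp ℂ (A ⧸ K) (LinearMap.fst ℂ (A ⧸ K) (A ⧸ K)) ∘ₗ μ ∘ₗ s +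
      LinearMap.lcomp ℂ (A ⧸ K) (LinearMap.snd ℂ (A ⧸ K) (A ⧸ K)) ∘ₗ μ ∘ₗ t
  let T₀ : ((A ⧸ K) × (A ⧸ K)) →ₗ[ℂ] (A ⧸ K) := μ r ∘ₗ LinearMap.snd ℂ (A ⧸ K) (A ⧸ K)
  have hT (w : W) : T w + T₀ = (LinearMap.mul ℂ (A ⧸ K) (Ideal.Quotient.mk K (s w))).coprod
      (LinearMap.mul ℂ (A ⧸ K) (Ideal.Quotient.mk K (t w + r))) := by
    refine LinearMap.ext fun x ↦ ?_
    change Ideal.Quotient.mk K (s w) * x.1 + Ideal.Quotient.mk K (t w) * x.2 +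
      Ideal.Quotient.mk K r * x.2 =
      Ideal.Quotient.mk K (s w) * x.1 + Ideal.Quotient.mk K (t w + r) * x.2
    rw [map_add]
    ring
  refine (HoldsGenerally.finrank_range_le T T₀ w₀).mono fun w hw ↦ ?_
  rw [hT, hT] at hw
  have h1 := Ideal.length_quotient_add_finrank_range (k := ℂ) K (s w) (t w + r)
  have h2 := Ideal.length_quotient_add_finrank_range (k := ℂ) K (s w₀) (t w₀ + r)
  have hle (I : Ideal A) : Module.length A (A ⧸ (I ⊔ K)) = Module.finrank ℂ (A ⧸ (I ⊔ K)) := by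
    have := Ideal.finite_quotient_of_le (le_sup_right : K ≤ I ⊔ K) hfin
    rw [length_eq_length_of_residue _ hres, Module.length_eq_finrank]
  have h3 : Module.length A (A ⧸ (Ideal.span {s w} ⊔ Ideal.span {t w + r} ⊔ K)) ≤ l := by
    refine le_trans ?_ ((Ideal.length_quotient_le_of_le (le_sup_left :
      _ ≤ Ideal.span {s w₀} ⊔ Ideal.span {t w₀ + r} ⊔ K)).trans hl)
    rw [hle, hle, Nat.cast_le]
    omega
  have h4 : maximalIdeal A ^ l ≤ Ideal.span {s w} ⊔ Ideal.span {t w + r} := by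
    refine Submodule.le_of_le_smul_of_le_jacobson_bot (I := maximalIdeal A)
      (IsNoetherian.noetherian _) (IsLocalRing.maximalIdeal_le_jacobson _) ?_
    rw [smul_eq_mul, ← pow_succ', ← hK]
    exact maximalIdeal_pow_le_of_length_le h3
  have h5 : Ideal.span {s w} ⊔ Ideal.span {t w + r} ⊔ K =
      Ideal.span {s w} ⊔ Ideal.span {t w + r} :=
    sup_eq_left.mpr (hK ▸ (Ideal.pow_le_pow_right l.le_succ).trans h4)
  rwa [h5] at h3

/-! ### Factoriality of regular local rings of dimension at most two -/

open IsLocalRing in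
theorem IsLocalRing.isPrincipalIdealRing_of_maximalIdeal_eq_span_singleton {Q : Type*}
    [CommRing Q] [IsLocalRing Q] [IsNoetherianRing Q] {y : Q}
    (hy : maximalIdeal Q = Ideal.span {y}) : IsPrincipalIdealRing Q := by
  refine IsPrincipalIdealRing.of_prime fun q hq ↦ ?_
  by_cases hyq : y ∈ q
  · refine ⟨y, le_antisymm ?_ ?_⟩
    · exact (le_maximalIdeal hq.ne_top).trans hy.le
    · exact (Ideal.span_singleton_le_iff_mem q).mpr hyq
  · have : q = ⊥ := by
      refine Submodule.eq_bot_of_le_smul_of_le_jacobson_bot (maximalIdeal Q) q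
        (IsNoetherian.noetherian _) (fun z hz ↦ ?_) (IsLocalRing.maximalIdeal_le_jacobson _)
      obtain ⟨c, rfl⟩ := Ideal.mem_span_singleton'.mp (hy ▸ le_maximalIdeal hq.ne_top hz)
      rw [mul_comm, smul_eq_mul]
      exact Ideal.mul_mem_mul (hy ▸ Ideal.mem_span_singleton_self y)
        ((hq.mem_or_mem hz).resolve_right hyq)
    rw [this]
    infer_instance

open IsLocalRing in
/-- If the maximal ideal of a Noetherian local ring is generated by two elements, every other prime
ideal is principal. -/
theorem IsLocalRing.isPrincipal_of_isPrime_of_ne {A : Type*} [CommRing A] [IsLocalRing A]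
    [IsNoetherianRing A] {x y : A} (hxy : maximalIdeal A = Ideal.span {x, y}) {p : Ideal A}
    (hp : p.IsPrime) (hpm : p ≠ maximalIdeal A) : p.IsPrincipal := by
  wlog hx : x ∉ p generalizing x y
  · have hy : y ∉ p := fun hy ↦ hpm (le_antisymm (le_maximalIdeal hp.ne_top) (by
      rw [hxy, Ideal.span_le]
      rintro z (rfl | rfl)
      · exact not_not.mp hx
      · exact hy))
    exact this (by rw [hxy, Set.pair_comm]) hy
  have hxm : x ∈ maximalIdeal A := hxy ▸ Ideal.subset_span (by simp)
  let π := Ideal.Quotient.mk (Ideal.span {x})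
  have hπ : Function.Surjective π := Ideal.Quotient.mk_surjective
  have : Nontrivial (A ⧸ Ideal.span {x}) := Ideal.Quotient.nontrivial_iff.mpr fun h ↦
    hxm (Ideal.span_singleton_eq_top.mp h)
  have : IsLocalRing (A ⧸ Ideal.span {x}) := .of_surjective' π hπ
  have hmax : maximalIdeal (A ⧸ Ideal.span {x}) = Ideal.span {π y} := by
    rw [← map_maximalIdeal_of_surjective π hπ, hxy, Ideal.map_span, Set.image_pair,
      Ideal.span_insert]
    have : π x = 0 := Ideal.Quotient.eq_zero_iff_mem.mpr (Ideal.mem_span_singleton_self x)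
    simp [this]
  have := isPrincipalIdealRing_of_maximalIdeal_eq_span_singleton hmax
  obtain ⟨b, hb⟩ := (IsPrincipalIdealRing.principal (p.map π)).principal
  have hbp : b ∈ p.map π := hb ▸ Submodule.mem_span_singleton_self b
  obtain ⟨a, ha, rfl⟩ := (Ideal.mem_map_iff_of_surjective π hπ).mp hbp
  refine ⟨a, le_antisymm ?_ ((Ideal.span_singleton_le_iff_mem p).mpr ha)⟩
  -- An element of `p` is a multiple of `a` plus a multiple of `x`; since `x ∉ p`, the cofactor of
  -- `x` lies in `p`. Thus `p ⊆ (a) + m p`.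
  refine Submodule.le_of_le_smul_of_le_jacobson_bot (I := maximalIdeal A)
    (IsNoetherian.noetherian _) (IsLocalRing.maximalIdeal_le_jacobson _) fun z hz ↦ ?_
  have hz' : π z ∈ Submodule.span _ {π a} := hb ▸ Ideal.mem_map_of_mem π hz
  obtain ⟨c, hc⟩ := Ideal.mem_span_singleton'.mp hz'
  obtain ⟨c, rfl⟩ := hπ c
  rw [← map_mul, Ideal.Quotient.eq] at hc
  obtain ⟨d, hd⟩ := Ideal.mem_span_singleton'.mp hc
  have hdx : d * x ∈ p := hd ▸ sub_mem (p.mul_mem_left c ha) hz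
  have : z = c * a - x * d := by rw [mul_comm x, hd]; ring
  rw [this]
  refine sub_mem (Submodule.mem_sup_left ?_) (Submodule.mem_sup_right ?_)
  · exact Ideal.mul_mem_left _ c (Ideal.mem_span_singleton_self a)
  · exact Ideal.mul_mem_mul hxm ((hp.mem_or_mem hdx).resolve_right hx)

open IsLocalRing in
theorem IsRegularLocalRing.exists_maximalIdeal_eq_span_pair {A : Type*} [CommRing A]
    [IsRegularLocalRing A] (hdim : ringKrullDim A ≤ 2) :
    ∃ x y : A, maximalIdeal A = Ideal.span {x, y} := by
  classical
  obtain ⟨s, hs, hspan⟩ := Submodule.FG.exists_span_finset_card_eq_spanFinrank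
    (IsNoetherian.noetherian (maximalIdeal A))
  have h2 : s.card ≤ 2 := by
    rw [hs]
    have := IsRegularLocalRing.spanFinrank_maximalIdeal (R := A)
    rw [← this] at hdim
    exact_mod_cast hdim
  have h3 : ∃ x y : A, Ideal.span (s : Set A) = Ideal.span {x, y} := by
    interval_cases h : s.card
    · rw [Finset.card_eq_zero.mp h]
      exact ⟨0, 0, by simp⟩
    · obtain ⟨x, rfl⟩ := Finset.card_eq_one.mp h
      exact ⟨x, x, by simp⟩
    · obtain ⟨x, y, -, rfl⟩ := Finset.card_eq_two.mp h
      exact ⟨x, y, by simp⟩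
  obtain ⟨x, y, h4⟩ := h3
  exact ⟨x, y, hspan.symm.trans h4⟩

open IsLocalRing in
-- Primes of height one are principal: the maximal ideal, if it has height one, by regularity, and
-- all others because the maximal ideal has two generators.
theorem IsRegularLocalRing.uniqueFactorizationMonoid {A : Type*} [CommRing A] [IsDomain A]
    [IsRegularLocalRing A] (hdim : ringKrullDim A ≤ 2) : UniqueFactorizationMonoid A := by
  obtain ⟨x, y, hxy⟩ := exists_maximalIdeal_eq_span_pair hdim
  refine UniqueFactorizationMonoid.of_forall_isPrincipal_of_height_eq_one fun p hp hph ↦ ?_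
  by_cases hpm : p = maximalIdeal A
  · rw [hpm, ← WithBot.coe_inj, maximalIdeal_height_eq_ringKrullDim,
      ← IsRegularLocalRing.spanFinrank_maximalIdeal] at hph
    rw [hpm]
    exact ((Submodule.spanFinrank_eq_one_iff _).mp (by exact_mod_cast hph)).1
  · exact isPrincipal_of_isPrime_of_ne hxy hp hpm

/-! ### Intersection multiplicities on a smooth surface germ -/

open IsLocalRing in
-- A non-maximal prime containing `f` and `r` would be generated by a common prime factor.
theorem IsLocalRing.length_quotient_sup_ne_top {A : Type*} [CommRing A] [IsLocalRing A]
    [IsNoetherianRing A] {x y : A} (hxy : maximalIdeal A = Ideal.span {x, y}) {f r : A}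
    (hr : r ≠ 0) (hfr : ∀ π : A, Prime π → π ∣ r → ¬ π ∣ f) :
    Module.length A (A ⧸ (Ideal.span {f} ⊔ Ideal.span {r})) ≠ ⊤ := by
  refine length_quotient_ne_top fun p hp hle ↦ ?_
  by_contra hpm
  obtain ⟨π, rfl⟩ := (isPrincipal_of_isPrime_of_ne hxy hp hpm).principal
  have hr' : π ∣ r := Ideal.mem_span_singleton.mp
    (hle (Submodule.mem_sup_right (Ideal.mem_span_singleton_self r)))
  have hf' : π ∣ f := Ideal.mem_span_singleton.mp
    (hle (Submodule.mem_sup_left (Ideal.mem_span_singleton_self f)))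
  have hπ : π ≠ 0 := by
    rintro rfl
    exact hr (zero_dvd_iff.mp hr')
  exact hfr π ((Ideal.span_singleton_prime hπ).mp hp) hr' hf'

theorem Ideal.exists_eq_sum_of_mem_span_pair_pow {A : Type*} [CommRing A] {x y r : A} {n : ℕ}
    (hr : r ∈ span {x, y} ^ n) :
    ∃ c : ℕ → A, r = ∑ i ∈ Finset.range (n + 1), c i * (x ^ (n - i) * y ^ i) := by
  induction n generalizing r with
  | zero => exact ⟨fun _ ↦ r, by simp⟩
  | succ n ih =>
    obtain ⟨a, ha, b, hb, rfl⟩ := Submodule.mem_sup.mp (span_pair_pow_succ_le x y n hr)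
    obtain ⟨r', hr', rfl⟩ := Ideal.mem_span_singleton_mul.mp ha
    obtain ⟨d, rfl⟩ := Ideal.mem_span_singleton'.mp hb
    obtain ⟨c, rfl⟩ := ih hr'
    refine ⟨fun i ↦ if i = n + 1 then d else c i, ?_⟩
    rw [Finset.sum_range_succ _ (n + 1), Nat.sub_self, pow_zero, one_mul,
      Finset.mul_sum]
    simp only [if_pos]
    congr 1
    refine Finset.sum_congr rfl fun i hi ↦ ?_
    have hi' : i < n + 1 := Finset.mem_range.mp hi
    rw [if_neg hi'.ne, show n + 1 - i = n - i + 1 by omega, pow_succ]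
    ring

open IsLocalRing in
/-- A general line through the origin of a smooth surface germ meets a curve of multiplicity `n` at
most `n` times. -/
theorem IsLocalRing.exists_mem_length_quotient_sup_le {k A : Type*} [Field k] [Infinite k]
    [CommRing A] [IsLocalRing A] [Algebra k A]
    (hres : ∀ a : A, ∃ c : k, a - algebraMap k A c ∈ maximalIdeal A) {x y : A}
    (hxy : maximalIdeal A = Ideal.span {x, y}) {r : A} {n : ℕ} (hr : r ∈ maximalIdeal A ^ n)
    (hr' : r ∉ maximalIdeal A ^ (n + 1)) :
    ∃ g ∈ maximalIdeal A, Module.length A (A ⧸ (Ideal.span {r} ⊔ Ideal.span {g})) ≤ n := by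
  have hx : x ∈ maximalIdeal A := hxy ▸ Ideal.subset_span (by simp)
  have hy : y ∈ maximalIdeal A := hxy ▸ Ideal.subset_span (by simp)
  obtain ⟨c, hc⟩ := Ideal.exists_eq_sum_of_mem_span_pair_pow (hxy ▸ hr)
  choose a ha using fun i ↦ hres (c i)
  have hmem (i : ℕ) (hi : i < n + 1) : x ^ (n - i) * y ^ i ∈ maximalIdeal A ^ n := by
    have := Ideal.mul_mem_mul (Ideal.pow_mem_pow hx (n - i)) (Ideal.pow_mem_pow hy i)
    rwa [← pow_add, Nat.sub_add_cancel (Nat.lt_succ_iff.mp hi)] at this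
  have hne : ∃ i : Fin (n + 1), a i ≠ 0 := by
    by_contra! h0
    refine hr' (hc ▸ sum_mem fun i hi ↦ ?_)
    have hi' := Finset.mem_range.mp hi
    have h1 := ha i
    rw [h0 ⟨i, hi'⟩, map_zero, sub_zero] at h1
    rw [pow_succ']
    exact Ideal.mul_mem_mul h1 (hmem i hi')
  obtain ⟨s, hs⟩ := Polynomial.exists_sum_mul_pow_ne_zero hne
  set b : A := algebraMap k A s with hb
  -- On the line `y = b * x` the germ `r` restricts to `u * x ^ n`, and the choice of `s`, off the
  -- zeros of the leading form, makes `u` a unit.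
  let u : A := ∑ i ∈ Finset.range (n + 1), c i * b ^ i
  have hu : IsUnit u := by
    have h1 : u - algebraMap k A (∑ i : Fin (n + 1), a i * s ^ (i : ℕ)) ∈ maximalIdeal A := by
      rw [Fin.sum_univ_eq_sum_range (fun i ↦ a i * s ^ i), map_sum, ← Finset.sum_sub_distrib]
      refine sum_mem fun i _ ↦ ?_
      rw [map_mul, map_pow, ← hb, ← sub_mul]
      exact Ideal.mul_mem_right _ _ (ha i)
    by_contra h2
    have h3 := sub_mem ((mem_maximalIdeal u).mpr h2) h1
    rw [sub_sub_cancel] at h3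
    exact h3 ((isUnit_iff_ne_zero.mpr hs).map (algebraMap k A))
  refine ⟨y - b * x, sub_mem hy (Ideal.mul_mem_left _ _ hx), ?_⟩
  have hdvd : y - b * x ∣ r - u * x ^ n := by
    rw [hc, Finset.sum_mul, ← Finset.sum_sub_distrib]
    refine Finset.dvd_sum fun i hi ↦ ?_
    have hi' : n = n - i + i := by have := Finset.mem_range.mp hi; omega
    have : c i * (x ^ (n - i) * y ^ i) - c i * b ^ i * x ^ n =
        c i * x ^ (n - i) * (y ^ i - (b * x) ^ i) := by
      have h3 : x ^ n = x ^ (n - i) * x ^ i := by rw [← pow_add, ← hi']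
      rw [h3]
      ring
    rw [this]
    exact (sub_dvd_pow_sub_pow y (b * x) i).mul_left _
  have hle : Ideal.span {y - b * x} ⊔ Ideal.span {x ^ n} ≤
      Ideal.span {r} ⊔ Ideal.span {y - b * x} := by
    refine sup_le le_sup_right ?_
    rw [Ideal.span_singleton_le_iff_mem, ← Ideal.unit_mul_mem_iff_mem _ hu,
      show u * x ^ n = r - (r - u * x ^ n) by ring]
    exact sub_mem (Submodule.mem_sup_left (Ideal.mem_span_singleton_self r))
      (Submodule.mem_sup_right (Ideal.mem_span_singleton.mpr hdvd))
  have hmax : Ideal.span {y - b * x} ⊔ Ideal.span {x} = maximalIdeal A := by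
    refine le_antisymm (sup_le ?_ ?_) ?_
    · rw [Ideal.span_singleton_le_iff_mem]
      exact sub_mem hy (Ideal.mul_mem_left _ _ hx)
    · rwa [Ideal.span_singleton_le_iff_mem]
    · rw [hxy, Ideal.span_le]
      have h4 : x ∈ Ideal.span {y - b * x} ⊔ Ideal.span {x} :=
        Submodule.mem_sup_right (Ideal.mem_span_singleton_self x)
      rintro z (rfl | rfl)
      · exact h4
      · refine (Submodule.sub_mem_iff_left _ (Ideal.mul_mem_left _ b h4)).mp ?_
        exact Submodule.mem_sup_left (Ideal.mem_span_singleton_self _)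
  refine (Ideal.length_quotient_le_of_le hle).trans
    ((Ideal.length_quotient_sup_pow_le (k := A) _ x n).trans ?_)
  have h1 : Module.length A (A ⧸ maximalIdeal A) = 1 := by
    rw [Module.length_eq_one_iff, isSimpleModule_iff_quot_maximal]
    exact ⟨maximalIdeal A, inferInstance, ⟨LinearEquiv.refl _ _⟩⟩
  rw [hmax, h1, mul_one]

/-- Each of the finitely many prime factors of `r`, up to associates, excludes a proper subspace of
`W`, and finitely many proper subspaces do not cover a space over an infinite field. -/
theorem UniqueFactorizationMonoid.exists_apply_forall_not_dvd {k A W : Type*} [Field k] [Infinite k]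
    [CommRing A] [IsDomain A] [UniqueFactorizationMonoid A] [Algebra k A] [AddCommGroup W]
    [Module k W] (s : W →ₗ[k] A) (hs : ∀ π : A, Prime π → ∃ w, ¬ π ∣ s w) {r : A} (hr : r ≠ 0) :
    ∃ w, ∀ π : A, Prime π → π ∣ r → ¬ π ∣ s w := by
  classical
  let D (π : A) : Submodule k W := ((Ideal.span {π}).restrictScalars k).comap s
  have hD (π : A) (w : W) : w ∈ D π ↔ π ∣ s w := Ideal.mem_span_singleton
  let T : Finset (Subspace k W) := (factors r).toFinset.image D
  have hT : ⊤ ∉ T := by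
    intro h
    obtain ⟨π, hπ, hπT⟩ := Finset.mem_image.mp h
    obtain ⟨w, hw⟩ := hs π (prime_of_factor π (Multiset.mem_toFinset.mp hπ))
    exact hw ((hD π w).mp (hπT ▸ Submodule.mem_top))
  obtain ⟨w, hw⟩ := (Set.ne_univ_iff_exists_notMem _).mp
    (Subspace.biUnion_ne_univ_of_top_notMem hT)
  refine ⟨w, fun π hπ hπr hπw ↦ hw ?_⟩
  obtain ⟨q, hq, hqπ⟩ := exists_mem_factors_of_dvd hr hπ.irreducible hπr
  refine Set.mem_biUnion (Finset.mem_image_of_mem D (Multiset.mem_toFinset.mpr hq)) ?_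
  exact (hD q w).mpr (hqπ.dvd_iff_dvd_left.mp hπw)

open IsLocalRing in
/-- If `(a, b)` has colength `l`, every vector space of elements containing `a` and `b` has a member
meeting `r` in colength at most `n * l`, where `n` is the multiplicity of `r`. -/
theorem IsLocalRing.exists_mem_length_quotient_le_mul {k A : Type*} [Field k] [Infinite k]
    [CommRing A] [IsDomain A] [UniqueFactorizationMonoid A] [IsLocalRing A] [IsNoetherianRing A]
    [Algebra k A] (hres : ∀ a : A, ∃ c : k, a - algebraMap k A c ∈ maximalIdeal A) {x y : A}
    (hxy : maximalIdeal A = Ideal.span {x, y}) {r : A} (hr0 : r ≠ 0) {n : ℕ}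
    (hr : r ∈ maximalIdeal A ^ n) (hr' : r ∉ maximalIdeal A ^ (n + 1)) {V : Submodule k A}
    {f : A} (hfV : f ∈ V) (hfr : ∀ π : A, Prime π → π ∣ r → ¬ π ∣ f) {a b : A} (ha : a ∈ V)
    (hb : b ∈ V) (hab : Module.length A (A ⧸ (Ideal.span {a} ⊔ Ideal.span {b})) ≠ ⊤) :
    ∃ d ∈ V, Module.length A (A ⧸ (Ideal.span {d} ⊔ Ideal.span {r})) ≤
      n * Module.length A (A ⧸ (Ideal.span {a} ⊔ Ideal.span {b})) := by
  by_cases hru : IsUnit r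
  · refine ⟨f, hfV, ?_⟩
    rw [Module.length_eq_zero_iff.mpr (Ideal.Quotient.subsingleton_iff.mpr (by
      rw [Ideal.span_singleton_eq_top.mpr hru, sup_top_eq]))]
    exact zero_le
  have hlen (I : Ideal A) : Module.length A (A ⧸ I) = Module.length k (A ⧸ I) :=
    length_eq_length_of_residue _ hres
  obtain ⟨l, hl⟩ := ENat.ne_top_iff_exists.mp hab
  obtain ⟨g, hg, hgn⟩ := exists_mem_length_quotient_sup_le hres hxy hr hr'
  let φ : A →ₐ[k] A ⧸ Ideal.span {r} := Ideal.Quotient.mkₐ k (Ideal.span {r})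
  have hφ : Function.Surjective φ := Ideal.Quotient.mk_surjective
  have : Nontrivial (A ⧸ Ideal.span {r}) := Ideal.Quotient.nontrivial_iff.mpr fun h ↦
    hru (Ideal.span_singleton_eq_top.mp h)
  have : IsLocalRing (A ⧸ Ideal.span {r}) := .of_surjective' φ.toRingHom hφ
  have hB (z : A) : Module.length k ((A ⧸ Ideal.span {r}) ⧸ Ideal.span {φ z}) =
      Module.length A (A ⧸ (Ideal.span {z} ⊔ Ideal.span {r})) := by
    rw [hlen, sup_comm]
    have h1 : Ideal.span {φ z} = (Ideal.span {z}).map φ := by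
      rw [Ideal.map_span, Set.image_singleton]
    rw [h1]
    exact (DoubleQuot.quotQuotEquivQuotSupₐ k (Ideal.span {r})
      (Ideal.span {z})).toLinearEquiv.length_eq
  have hnz : φ f ∈ nonZeroDivisors (A ⧸ Ideal.span {r}) := by
    rw [mem_nonZeroDivisors_iff_right]
    intro z hz
    obtain ⟨z, rfl⟩ := hφ z
    rw [← map_mul] at hz
    have h1 : r ∣ z * f := Ideal.mem_span_singleton.mp (Ideal.Quotient.eq_zero_iff_mem.mp hz)
    have h2 : r ∣ z := UniqueFactorizationMonoid.dvd_of_dvd_mul_left_of_no_prime_factors hr0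
      (fun {d} h3 h4 h5 ↦ hfr d h5 h3 h4) h1
    exact Ideal.Quotient.eq_zero_iff_mem.mpr (Ideal.mem_span_singleton.mpr h2)
  have hfin : Module.Finite k ((A ⧸ Ideal.span {r}) ⧸ Ideal.span {φ f}) := by
    rw [Module.finite_iff_length_ne_top, hB]
    exact length_quotient_sup_ne_top hxy hr0 hfr
  -- Colength `l` of `(a, b)` gives `m ^ l ⊆ (a, b)`; the transversal `g` thus yields an element of
  -- the ideal of `V` with controlled colength modulo `r`.
  have hgl : φ (g ^ l) ∈ Ideal.span ((V.map φ.toLinearMap : Submodule k _) : Set (A ⧸ _)) := by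
    have h1 : g ^ l ∈ Ideal.span {a} ⊔ Ideal.span {b} :=
      maximalIdeal_pow_le_of_length_le hl.symm.le (Ideal.pow_mem_pow hg l)
    have h2 : Ideal.span {a} ⊔ Ideal.span {b} ≤ Ideal.span (V : Set A) :=
      sup_le ((Ideal.span_singleton_le_iff_mem _).mpr (Ideal.subset_span ha))
        ((Ideal.span_singleton_le_iff_mem _).mpr (Ideal.subset_span hb))
    have h3 := Ideal.mem_map_of_mem φ (h2 h1)
    rwa [Ideal.map_span] at h3
  obtain ⟨_, ⟨d, hd, rfl⟩, hle⟩ := Ideal.exists_mem_length_quotient_span_le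
    (V := V.map φ.toLinearMap) ⟨f, hfV, rfl⟩ hnz hfin hgl
  refine ⟨d, hd, ?_⟩
  rw [← hB, ← hl]
  refine hle.trans ?_
  rw [hB, sup_comm]
  refine (Ideal.length_quotient_sup_pow_le (k := A) _ g l).trans ?_
  rw [mul_comm]
  gcongr

open IsLocalRing in
theorem IsLocalRing.exists_mem_pow_notMem_pow_succ {A : Type*} [CommRing A] [IsLocalRing A]
    [IsNoetherianRing A] {r : A} (hr : r ≠ 0) :
    ∃ n, r ∈ maximalIdeal A ^ n ∧ r ∉ maximalIdeal A ^ (n + 1) := by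
  by_contra! h
  have h1 (n : ℕ) : r ∈ maximalIdeal A ^ n := by
    induction n with
    | zero => simp
    | succ n ih => exact h n ih
  have h2 : r ∈ ⨅ i : ℕ, maximalIdeal A ^ i := Submodule.mem_iInf _ |>.mpr h1
  rw [Ideal.iInf_pow_eq_bot_of_isLocalRing _ Ideal.IsPrime.ne_top'] at h2
  exact hr h2

open IsLocalRing in
/-- The comparison of local intersection multiplicities, for a vector space of germs without common
factor on a smooth surface germ. -/
theorem IsLocalRing.holdsGenerally_length_quotient {A W : Type*} [CommRing A] [IsDomain A]
    [UniqueFactorizationMonoid A] [IsLocalRing A] [IsNoetherianRing A] [Algebra ℂ A]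
    (hres : ∀ a : A, ∃ c : ℂ, a - algebraMap ℂ A c ∈ maximalIdeal A) {x y : A}
    (hxy : maximalIdeal A = Ideal.span {x, y}) [AddCommGroup W] [Module ℂ W] (s : W →ₗ[ℂ] A)
    (hne : ∃ w, s w ≠ 0) (hs : ∀ π : A, Prime π → ∃ w, ¬ π ∣ s w) {r : A} (hr : r ≠ 0) {M : ℕ∞}
    (hM : ∀ n : ℕ, r ∈ maximalIdeal A ^ n → n ≤ M) :
    HoldsGenerally fun w : W × W ↦ s w.1 ≠ 0 ∧ s w.2 ≠ 0 ∧
      Module.length A (A ⧸ (Ideal.span {s w.1} ⊔ Ideal.span {r})) ≠ ⊤ ∧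
      Module.length A (A ⧸ (Ideal.span {s w.1} ⊔ Ideal.span {s w.2})) ≠ ⊤ ∧
      Module.length A (A ⧸ (Ideal.span {s w.1} ⊔ Ideal.span {r})) =
        Module.length A (A ⧸ (Ideal.span {s w.2} ⊔ Ideal.span {r})) ∧
      Module.length A (A ⧸ (Ideal.span {s w.1} ⊔ Ideal.span {r})) ≤
        M * Module.length A (A ⧸ (Ideal.span {s w.1} ⊔ Ideal.span {s w.2})) := by
  obtain ⟨v, hv⟩ := hne
  obtain ⟨v', hv'⟩ := UniqueFactorizationMonoid.exists_apply_forall_not_dvd s hs hv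
  obtain ⟨u, hu⟩ := UniqueFactorizationMonoid.exists_apply_forall_not_dvd s hs hr
  let e (w : W) : ℕ∞ := Module.length A (A ⧸ (Ideal.span {s w} ⊔ Ideal.span {r}))
  -- The generic value is the minimum: semicontinuity bounds general values by it from above,
  -- minimality from below.
  obtain ⟨w₀, hw₀⟩ : ∃ w₀, ∀ w, e w₀ ≤ e w := ⟨Function.argmin e, fun w ↦ Function.argmin_le e w⟩
  obtain ⟨m, hm⟩ := ENat.ne_top_iff_exists.mp (ne_top_of_le_ne_top
    (length_quotient_sup_ne_top hxy hr hu) (hw₀ u))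
  have hvv' := length_quotient_sup_ne_top hxy hv hv'
  rw [sup_comm] at hvv'
  obtain ⟨l, hl⟩ := ENat.ne_top_iff_exists.mp hvv'
  have h1 := HoldsGenerally.ne_zero (s ∘ₗ LinearMap.fst ℂ W W) (w₀ := (v, v)) hv
  have h2 := HoldsGenerally.ne_zero (s ∘ₗ LinearMap.snd ℂ W W) (w₀ := (v, v)) hv
  have h3 := HoldsGenerally.length_quotient_le hres (s ∘ₗ LinearMap.fst ℂ W W) 0 r (w₀, w₀)
    (l := m) (by rw [hm, LinearMap.zero_apply, zero_add]; rfl)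
  have h4 := HoldsGenerally.length_quotient_le hres (s ∘ₗ LinearMap.snd ℂ W W) 0 r (w₀, w₀)
    (l := m) (by rw [hm, LinearMap.zero_apply, zero_add]; rfl)
  have h5 := HoldsGenerally.length_quotient_le hres (s ∘ₗ LinearMap.fst ℂ W W)
    (s ∘ₗ LinearMap.snd ℂ W W) 0 (v, v') (l := l) (by rw [hl, add_zero]; rfl)
  refine (h1.and (h2.and (h3.and (h4.and h5)))).mono ?_
  rintro ⟨w, w'⟩ ⟨hw, hw', hwr, hw'r, hww'⟩
  rw [LinearMap.zero_apply, zero_add] at hwr hw'r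
  rw [add_zero] at hww'
  change Module.length A (A ⧸ (Ideal.span {s w} ⊔ Ideal.span {s w'})) ≤ l at hww'
  have hww'top := ne_top_of_le_ne_top (ENat.natCast_ne_top l) hww'
  have h6 : e w = m := le_antisymm hwr (hm ▸ hw₀ w)
  have h7 : e w' = m := le_antisymm hw'r (hm ▸ hw₀ w')
  refine ⟨hw, hw', ?_, hww'top, h6.trans h7.symm, ?_⟩
  · exact h6.trans_ne (ENat.natCast_ne_top m)
  · obtain ⟨n, hn, hn'⟩ := exists_mem_pow_notMem_pow_succ hr
    obtain ⟨_, ⟨d, rfl⟩, hd⟩ := exists_mem_length_quotient_le_mul hres hxy hr hn hn'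
      (V := LinearMap.range s) ⟨u, rfl⟩ hu ⟨w, rfl⟩ ⟨w', rfl⟩ hww'top
    have h8 : e w ≤ e d := (h6.trans hm) ▸ hw₀ d
    refine (h8.trans hd).trans ?_
    gcongr
    exact hM n hn

/-! ### Orders of rational functions along prime divisors through a point -/

theorem Int.map_zpow_of_map_mul {K : Type*} [Field K] (v : K → ℤ)
    (hv : ∀ f g : K, f ≠ 0 → g ≠ 0 → v (f * g) = v f + v g) {f : K} (hf : f ≠ 0) (n : ℤ) :
    v (f ^ n) = n * v f := by
  have h1 : v 1 = 0 := by simpa using hv 1 1 one_ne_zero one_ne_zero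
  induction n with
  | zero => simp [h1]
  | succ n ih =>
    rw [zpow_add_one₀ hf, hv _ _ (zpow_ne_zero _ hf) hf, ih]
    ring
  | pred n ih =>
    have h2 := hv (f ^ (-(n : ℤ) - 1)) f (zpow_ne_zero _ hf) hf
    rw [← zpow_add_one₀ hf, sub_add_cancel, ih] at h2
    linarith

theorem Int.map_prod_zpow_of_map_mul {K ι : Type*} [Field K] (v : K → ℤ)
    (hv : ∀ f g : K, f ≠ 0 → g ≠ 0 → v (f * g) = v f + v g) (T : Finset ι) (f : ι → K)
    (hf : ∀ i ∈ T, f i ≠ 0) (n : ι → ℤ) :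
    v (∏ i ∈ T, f i ^ n i) = ∑ i ∈ T, n i * v (f i) := by
  classical
  induction T using Finset.induction_on with
  | empty => simpa using hv 1 1 one_ne_zero one_ne_zero
  | insert j T hj ih =>
    rw [Finset.prod_insert hj, Finset.sum_insert hj, hv, ih,
      map_zpow_of_map_mul v hv (hf j (Finset.mem_insert_self _ _))]
    · exact fun i hi ↦ hf i (Finset.mem_insert_of_mem hi)
    · exact zpow_ne_zero _ (hf j (Finset.mem_insert_self _ _))
    · exact Finset.prod_ne_zero_iff.mpr fun i hi ↦
        zpow_ne_zero _ (hf i (Finset.mem_insert_of_mem hi))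

namespace AlgebraicGeometry.Scheme

variable {X : Scheme.{0}}

/-- The prime ideal of the local ring at `O` that defines the closure of a point `C` through `O`. -/
noncomputable def primeAt {C O : X} (h : C ⤳ O) : Ideal (X.presheaf.stalk O) :=
  (IsLocalRing.maximalIdeal (X.presheaf.stalk C)).comap (X.presheaf.stalkSpecializes h).hom

instance {C O : X} (h : C ⤳ O) : (primeAt h).IsPrime := by
  unfold primeAt
  infer_instance

theorem fromSpecStalk_primeAt {C O : X} (h : C ⤳ O) :
    X.fromSpecStalk O ⟨primeAt h, inferInstance⟩ = C := by
  have h1 := fromSpecStalk_closedPoint (x := C)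
  rw [← SpecMap_stalkSpecializes_fromSpecStalk h] at h1
  exact h1

theorem eq_of_primeAt_eq {C C' O : X} {h : C ⤳ O} {h' : C' ⤳ O} (hp : primeAt h = primeAt h') :
    C = C' := by
  rw [← fromSpecStalk_primeAt h, ← fromSpecStalk_primeAt h']
  exact congrArg (X.fromSpecStalk O) (PrimeSpectrum.ext hp)

/-- The spectrum of the local ring at `O` embeds in `X` with image the generizations of `O`. -/
theorem exists_primeAt_eq {O : X} (p : Ideal (X.presheaf.stalk O)) [hp : p.IsPrime] :
    ∃ (C : X) (h : C ⤳ O), primeAt h = p := by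
  let P : Spec (X.presheaf.stalk O) := ⟨p, hp⟩
  have h : X.fromSpecStalk O P ⤳ O := by
    have : X.fromSpecStalk O P ∈ Set.range (X.fromSpecStalk O) := ⟨P, rfl⟩
    rwa [range_fromSpecStalk] at this
  refine ⟨_, h, ?_⟩
  have h1 := (X.fromSpecStalk O).isEmbedding.injective (fromSpecStalk_primeAt h)
  exact congrArg PrimeSpectrum.asIdeal h1

theorem algebraMap_stalkSpecializes [IrreducibleSpace X] {C O : X} (h : C ⤳ O)
    (a : X.presheaf.stalk O) :
    algebraMap (X.presheaf.stalk C) X.functionField ((X.presheaf.stalkSpecializes h).hom a) =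
      algebraMap (X.presheaf.stalk O) X.functionField a := by
  have := X.presheaf.stalkSpecializes_comp
    ((genericPoint_spec X).specializes (Set.mem_univ C)) h
  exact congrArg (fun f ↦ f.hom a) this

/-- An affine neighbourhood of `O` also contains `C`, so a germ at `C` is a fraction of sections
there, and these have germs at `O`. -/
theorem isLocalization_primeAt [IsIntegral X] {C O : X} (h : C ⤳ O) :
    letI := (X.presheaf.stalkSpecializes h).hom.toAlgebra
    IsLocalization.AtPrime (X.presheaf.stalk C) (primeAt h) := by
  let := (X.presheaf.stalkSpecializes h).hom.toAlgebra
  have hinj : Function.Injective (algebraMap (X.presheaf.stalk O) (X.presheaf.stalk C)) := by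
    intro a b hab
    refine IsFractionRing.injective (X.presheaf.stalk O) X.functionField ?_
    rw [← algebraMap_stalkSpecializes h, ← algebraMap_stalkSpecializes h]
    exact congrArg _ hab
  refine ⟨?_, ?_, ?_⟩
  · rintro ⟨b, hb⟩
    exact not_not.mp hb
  · intro z
    obtain ⟨_, ⟨U, hU, rfl⟩, hOU, -⟩ :=
      X.isBasis_affineOpens.exists_subset_of_mem_open (Set.mem_univ O) isOpen_univ
    have hCU : C ∈ U := h.mem_open U.isOpen hOU
    let := TopCat.Presheaf.algebra_section_stalk X.presheaf (⟨C, hCU⟩ : U)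
    have := IsAffineOpen.isLocalization_stalk hU ⟨C, hCU⟩
    obtain ⟨⟨a, b⟩, hab⟩ := IsLocalization.surj (IsAffineOpen.primeIdealOf hU ⟨C, hCU⟩).asIdeal.primeCompl z
    have hgerm (c : Γ(X, U)) : (X.presheaf.stalkSpecializes h).hom (X.presheaf.germ U O hOU c) =
        algebraMap Γ(X, U) (X.presheaf.stalk C) c :=
      congrArg (fun f ↦ f.hom c) (X.presheaf.germ_stalkSpecializes (U := U) hOU h)
    refine ⟨(X.presheaf.germ U O hOU a, ⟨X.presheaf.germ U O hOU b, ?_⟩), ?_⟩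
    · intro hb
      have hb' : (X.presheaf.stalkSpecializes h).hom (X.presheaf.germ U O hOU b) ∈
        IsLocalRing.maximalIdeal (X.presheaf.stalk C) := hb
      rw [hgerm] at hb'
      exact hb' (IsLocalization.map_units (X.presheaf.stalk C) b)
    · change z * (X.presheaf.stalkSpecializes h).hom (X.presheaf.germ U O hOU b) =
        (X.presheaf.stalkSpecializes h).hom (X.presheaf.germ U O hOU a)
      rw [hgerm, hgerm]
      exact hab
  · intro a b hab
    exact ⟨1, by rw [hinj hab]⟩

theorem height_primeAt [IsIntegral X] {C O : X} (h : C ⤳ O) :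
    (primeAt h).height = Order.coheight C := by
  let := (X.presheaf.stalkSpecializes h).hom.toAlgebra
  have := isLocalization_primeAt h
  rw [← WithBot.coe_inj, ← ringKrullDim_stalk_eq_coheight,
    IsLocalization.AtPrime.ringKrullDim_eq_height (primeAt h)]

theorem exists_prime_primeAt_eq [IsIntegral X] {C O : X} [UniqueFactorizationMonoid (X.presheaf.stalk O)]
    (h : C ⤳ O) (hC : Order.coheight C = 1) :
    ∃ π : X.presheaf.stalk O, Prime π ∧ primeAt h = Ideal.span {π} := by
  have hph : (primeAt h).height = 1 := by rw [height_primeAt, hC]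
  obtain ⟨π, hπ⟩ := (UniqueFactorizationMonoid.isPrincipal_of_height_eq_one hph).principal
  have hπ0 : π ≠ 0 := by
    rintro rfl
    exact (primeAt h).ne_bot_of_height_eq_one hph (by rw [hπ]; simp)
  refine ⟨π, ?_, hπ⟩
  rw [← Ideal.span_singleton_prime hπ0]
  change Ideal.IsPrime (Submodule.span _ {π})
  rw [← hπ]
  infer_instance

variable [IsIntegral X] [IsLocallyNoetherian X]

theorem ord_algebraMap_eq_zero {C O : X} (h : C ⤳ O) {a : X.presheaf.stalk O}
    (ha : a ∉ primeAt h) : ord (algebraMap _ X.functionField a) C = 0 := by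
  by_cases hC : Order.coheight C = 1
  · have : Ring.KrullDimLE 1 (X.presheaf.stalk C) := krullDimLE_of_coheight_le hC.le
    have hu : IsUnit ((X.presheaf.stalkSpecializes h).hom a) := not_not.mp ha
    have ha0 : a ≠ 0 := fun h0 ↦ ha (h0 ▸ Ideal.zero_mem _)
    rw [ord_eq_iff hC (by simpa using ha0), ← algebraMap_stalkSpecializes h]
    exact Ring.ordFrac_of_isUnit hu
  · exact ord_eq_zero_of_coheight_neq_one hC _

theorem ord_algebraMap_nonneg {C O : X} (h : C ⤳ O) {a : X.presheaf.stalk O} (ha : a ≠ 0) :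
    0 ≤ ord (algebraMap _ X.functionField a) C := by
  by_cases hC : Order.coheight C = 1
  · have : Ring.KrullDimLE 1 (X.presheaf.stalk C) := krullDimLE_of_coheight_le hC.le
    have ha' : algebraMap _ X.functionField a ≠ 0 := by simpa using ha
    rw [le_ord_iff hC ha', ← algebraMap_stalkSpecializes h]
    refine Ring.ordFrac_ge_one_of_ne_zero fun h0 ↦ ha' ?_
    rw [← algebraMap_stalkSpecializes h, h0, map_zero]
  · rw [ord_eq_zero_of_coheight_neq_one hC]

/-- The local ring at `C` is the localization at `(π)`, a discrete valuation ring with uniformizer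
`π`. -/
theorem ord_algebraMap_eq_one {C O : X} (h : C ⤳ O) (hC : Order.coheight C = 1)
    {π : X.presheaf.stalk O} (hπ : π ≠ 0) (hp : primeAt h = Ideal.span {π}) :
    ord (algebraMap _ X.functionField π) C = 1 := by
  let := (X.presheaf.stalkSpecializes h).hom.toAlgebra
  have := isLocalization_primeAt h
  have : Ring.KrullDimLE 1 (X.presheaf.stalk C) := krullDimLE_of_coheight_le hC.le
  set ϖ : X.presheaf.stalk C := (X.presheaf.stalkSpecializes h).hom π with hϖ
  have hπ' : algebraMap _ X.functionField π ≠ 0 := by simpa using hπ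
  have hϖ0 : ϖ ≠ 0 := fun h0 ↦ hπ' (by
    rw [← algebraMap_stalkSpecializes h, ← hϖ, h0, map_zero])
  have hmax : IsLocalRing.maximalIdeal (X.presheaf.stalk C) = Ideal.span {ϖ} := by
    rw [← IsLocalization.AtPrime.map_eq_maximalIdeal (primeAt h), hp, Ideal.map_span,
      Set.image_singleton]
    rfl
  have hprime : Prime ϖ := by
    rw [← Ideal.span_singleton_prime hϖ0, ← hmax]
    infer_instance
  have hfield : ¬ IsField (X.presheaf.stalk C) := by
    rw [IsLocalRing.isField_iff_maximalIdeal_eq, hmax, Ideal.span_singleton_eq_bot]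
    exact hϖ0
  have : IsDiscreteValuationRing (X.presheaf.stalk C) :=
    ((IsDiscreteValuationRing.TFAE (X.presheaf.stalk C) hfield).out 0 4).mpr
      (Submodule.IsPrincipal.mk ⟨ϖ, hmax⟩)
  rw [ord_eq_iff hC hπ', ← algebraMap_stalkSpecializes h]
  exact Ring.ordFrac_irreducible hprime.irreducible

theorem exists_primeAt_eq_span_of_prime {O : X} {π : X.presheaf.stalk O} (hπ : Prime π) :
    ∃ (C : X) (h : C ⤳ O), Order.coheight C = 1 ∧ primeAt h = Ideal.span {π} := by
  have : (Ideal.span {π}).IsPrime := (Ideal.span_singleton_prime hπ.ne_zero).mpr hπ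
  obtain ⟨C, h, hp⟩ := exists_primeAt_eq (Ideal.span {π})
  refine ⟨C, h, ?_, hp⟩
  rw [← height_primeAt h, hp]
  refine le_antisymm (Ideal.height_le_one_of_isPrincipal_of_mem_minimalPrimes (Ideal.span {π}) _ ?_) ?_
  · rw [Ideal.minimalPrimes_eq_subsingleton_self]
    rfl
  · rw [Order.one_le_iff_ne_zero, Ne, Ideal.height_eq_zero_iff_eq_bot,
      Ideal.span_singleton_eq_bot]
    exact hπ.ne_zero

theorem one_le_ord_algebraMap {C O : X} (h : C ⤳ O) (hC : Order.coheight C = 1)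
    {π a : X.presheaf.stalk O} (hp : primeAt h = Ideal.span {π}) (ha : a ≠ 0) (hπa : π ∣ a) :
    1 ≤ ord (algebraMap _ X.functionField a) C := by
  obtain ⟨c, rfl⟩ := hπa
  have hπ := left_ne_zero_of_mul ha
  have hc := right_ne_zero_of_mul ha
  rw [map_mul, ord_mul (by simpa using hπ) (by simpa using hc), ord_algebraMap_eq_one h hC hπ hp]
  linarith [ord_algebraMap_nonneg h hc]

/-- A rational function without poles through a factorial point is regular there. -/
theorem exists_algebraMap_eq_of_ord_nonneg {O : X}
    [UniqueFactorizationMonoid (X.presheaf.stalk O)] {f : X.functionField} (hf : f ≠ 0)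
    (hord : ∀ C : X, Order.coheight C = 1 → C ⤳ O → 0 ≤ ord f C) :
    ∃ a, algebraMap (X.presheaf.stalk O) X.functionField a = f := by
  obtain ⟨a, b, hab, hfab⟩ := IsFractionRing.exists_reduced_fraction (A := X.presheaf.stalk O) f
  have hb0 : (b : X.presheaf.stalk O) ≠ 0 := nonZeroDivisors.coe_ne_zero b
  have hmul : f * algebraMap _ X.functionField (b : X.presheaf.stalk O) = algebraMap _ _ a := by
    rw [← hfab, IsLocalization.mk'_spec]
  by_cases hbu : IsUnit (b : X.presheaf.stalk O)
  · obtain ⟨c, hc⟩ := hbu.dvd (a := a)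
    refine ⟨c, ?_⟩
    have hb' : algebraMap _ X.functionField (b : X.presheaf.stalk O) ≠ 0 := by simp
    rw [hc, map_mul, mul_comm] at hmul
    exact (mul_left_cancel₀ hb' hmul).symm
  · exfalso
    obtain ⟨π, hπ, hπb⟩ := WfDvdMonoid.exists_irreducible_factor hbu hb0
    -- A prime factor of the denominator of a reduced fraction defines a divisor through `O` along
    -- which `f` has a pole.
    have hπ' := UniqueFactorizationMonoid.irreducible_iff_prime.mp hπ
    have hπa : ¬ π ∣ a := fun h ↦ hπ.not_isUnit (hab h hπb)
    obtain ⟨C, h, hC, hp⟩ := exists_primeAt_eq_span_of_prime hπ'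
    have h1 := hord C hC h
    have h2 := one_le_ord_algebraMap h hC hp hb0 hπb
    have h3 := congrArg (ord · C) hmul
    beta_reduce at h3
    rw [ord_mul hf (by simp), ord_algebraMap_eq_zero (a := a) h
      (by rwa [hp, Ideal.mem_span_singleton])] at h3
    linarith

/-- Every Weil divisor is principal near a factorial point. -/
theorem exists_ord_eq {O : X} [UniqueFactorizationMonoid (X.presheaf.stalk O)]
    (Z : AlgebraicCycle X ℤ) :
    ∃ f : X.functionField, f ≠ 0 ∧ ∀ C : X, Order.coheight C = 1 → C ⤳ O → ord f C = Z C := by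
  classical
  -- Every generization of `O` lies in each neighbourhood of `O`, so local finiteness leaves
  -- finitely many components through `O`.
  obtain ⟨t, ht, hfin⟩ := Z.supportLocallyFiniteWithinDomain' O (Set.mem_univ O)
  have hfin' : {C : X | C ⤳ O ∧ Z C ≠ 0}.Finite :=
    hfin.subset fun C hC ↦ ⟨mem_of_mem_nhds (hC.1 ht), hC.2⟩
  have hπ (C : X) : ∃ π : X.presheaf.stalk O, π ≠ 0 ∧ ∀ (h : C ⤳ O), Order.coheight C = 1 →
      Prime π ∧ primeAt h = Ideal.span {π} := by
    by_cases hC : C ⤳ O ∧ Order.coheight C = 1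
    · obtain ⟨π, hπ, hp⟩ := exists_prime_primeAt_eq hC.1 hC.2
      exact ⟨π, hπ.ne_zero, fun _ _ ↦ ⟨hπ, hp⟩⟩
    · exact ⟨1, one_ne_zero, fun h h' ↦ absurd ⟨h, h'⟩ hC⟩
  choose π hπ0 hπ using hπ
  have hπK (C : X) : algebraMap _ X.functionField (π C) ≠ 0 := by simpa using hπ0 C
  refine ⟨∏ C ∈ hfin'.toFinset with Order.coheight C = 1,
    algebraMap _ X.functionField (π C) ^ Z C, ?_, fun C hC hCO ↦ ?_⟩
  · exact Finset.prod_ne_zero_iff.mpr fun C _ ↦ zpow_ne_zero _ (hπK C)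
  · rw [Int.map_prod_zpow_of_map_mul (fun f ↦ ord f C) (fun f g hf hg ↦ ord_mul hf hg) _ _
      (fun C _ ↦ hπK C), Finset.sum_eq_single C]
    · rw [ord_algebraMap_eq_one hCO hC (hπ0 C) (hπ C hCO hC).2, mul_one]
    · intro C' hC' hne
      simp only [Finset.mem_filter, Set.Finite.mem_toFinset, Set.mem_ofPred_eq] at hC'
      obtain ⟨⟨hC'O, -⟩, hC'1⟩ := hC'
      rw [ord_algebraMap_eq_zero hCO, mul_zero]
      intro hmem
      refine hne (eq_of_primeAt_eq (h := hC'O) (h' := hCO) ?_)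
      have h1 := (hπ C hCO hC).2
      rw [h1, Ideal.mem_span_singleton] at hmem
      have h2 := (hπ C hCO hC).1.associated_of_dvd (hπ C' hC'O hC'1).1 hmem
      rw [h1, (hπ C' hC'O hC'1).2, Ideal.span_singleton_eq_span_singleton]
      exact h2.symm
    · intro hC'
      have : Z C = 0 := by
        by_contra h0
        exact hC' (by simp [hC, hCO, h0])
      rw [this, zero_mul]

end AlgebraicGeometry.Scheme

/-! ### Local equations on a normal surface -/

noncomputable section

namespace NormalSurface

variable (S : NormalSurface)

/-- The structure morphism makes every local ring of `S` an algebra over `ℂ`. -/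
instance algebraLocalRingAt (O : S.carrier) : Algebra ℂ (S.LocalRingAt O) :=
  RingHom.toAlgebra <|
    (S.carrier.presheaf.germ ⊤ O trivial).hom.comp <|
      (S.structureMap.appTop).hom.comp (Scheme.ΓSpecIso (CommRingCat.of ℂ)).inv.hom

instance (O : S.carrier) : IsScalarTower ℂ (S.LocalRingAt O) S.RatFun := by
  refine IsScalarTower.of_algebraMap_eq fun c ↦ ?_
  have := S.carrier.presheaf.germ_stalkSpecializes (U := ⊤) (y := O) trivial
    ((genericPoint_spec S.carrier).specializes (Set.mem_univ O))
  exact (congrArg (fun f ↦ f.hom (S.structureMap.appTop.hom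
    ((Scheme.ΓSpecIso (CommRingCat.of ℂ)).inv.hom c))) this).symm

variable {S}

theorem ringKrullDim_localRingAt_le (O : S.carrier) : ringKrullDim (S.LocalRingAt O) ≤ 2 := by
  rw [← PrimeSpectrum.topologicalKrullDim_eq_ringKrullDim, ← S.dim_eq_two]
  exact (S.carrier.fromSpecStalk O).isEmbedding.isInducing.topologicalKrullDim_le

theorem fromSpecStalk_structureMap (O : S.carrier) :
    S.carrier.fromSpecStalk O ≫ S.structureMap =
      Spec.map (CommRingCat.ofHom (algebraMap ℂ (S.LocalRingAt O))) := by
  have h1 : CommRingCat.ofHom (algebraMap ℂ (S.LocalRingAt O)) =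
      (Scheme.ΓSpecIso (CommRingCat.of ℂ)).inv ≫ S.structureMap.appTop ≫
        S.carrier.presheaf.germ ⊤ O trivial := rfl
  rw [h1, ← cancel_mono (Spec.map (Scheme.ΓSpecIso (CommRingCat.of ℂ)).hom), ← Spec.map_comp,
    Iso.hom_inv_id_assoc, SpecMap_ΓSpecIso_hom, Category.assoc, Scheme.toSpecΓ_naturality,
    Scheme.fromSpecStalk_toSpecΓ_assoc, Spec.map_comp]

/-- The Nullstellensatz: the residue field at a closed point is finite over `ℂ`, hence equal to it.
-/
theorem exists_sub_algebraMap_mem_maximalIdeal {O : S.carrier}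
    (hO : IsClosed ({O} : Set S.carrier)) (a : S.LocalRingAt O) :
    ∃ c : ℂ, a - algebraMap ℂ (S.LocalRingAt O) c ∈
      IsLocalRing.maximalIdeal (S.LocalRingAt O) := by
  have := isClosed_singleton_iff_isClosedImmersion.mp hO
  have := S.locallyOfFiniteType
  let ψ : ℂ →+* S.carrier.residueField O :=
    (S.carrier.residue O).hom.comp (algebraMap ℂ (S.LocalRingAt O))
  have h1 : S.carrier.fromSpecResidueField O ≫ S.structureMap =
      Spec.map (CommRingCat.ofHom ψ) := by
    rw [Scheme.fromSpecResidueField, Category.assoc, fromSpecStalk_structureMap, ← Spec.map_comp]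
    rfl
  have h2 : IsFinite (S.carrier.fromSpecResidueField O ≫ S.structureMap) :=
    isFinite_iff_locallyOfFiniteType_of_jacobsonSpace.mpr inferInstance
  rw [h1, IsFinite.SpecMap_iff] at h2
  obtain ⟨c, hc⟩ := (IsAlgClosed.ringHom_bijective_of_isIntegral ψ h2.to_isIntegral).2
    ((S.carrier.residue O).hom a)
  refine ⟨c, ?_⟩
  rw [← IsLocalRing.residue_eq_zero_iff, map_sub, sub_eq_zero]
  exact hc.symm

/-- If `g` vanishes at least to the orders of `d`, then `g / d` has no poles through `O` and is
therefore regular there. -/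
theorem idealAt_eq_span {O : S.carrier} [UniqueFactorizationMonoid (S.LocalRingAt O)]
    {Z : S.carrier → ℤ} {d : S.LocalRingAt O} (hd : d ≠ 0)
    (hZ : ∀ C : S.carrier, Order.coheight C = 1 → C ⤳ O →
      Scheme.ord (algebraMap (S.LocalRingAt O) S.RatFun d) C = Z C) :
    idealAt O Z = Ideal.span {d} := by
  have hdK : algebraMap (S.LocalRingAt O) S.RatFun d ≠ 0 := by simpa using hd
  refine le_antisymm (Ideal.span_le.mpr ?_) ?_
  · rintro g ⟨hg, hgZ⟩
    have hgK : algebraMap (S.LocalRingAt O) S.RatFun g ≠ 0 := by simpa using hg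
    obtain ⟨c, hc⟩ := Scheme.exists_algebraMap_eq_of_ord_nonneg (O := O)
      (f := algebraMap (S.LocalRingAt O) S.RatFun g / algebraMap (S.LocalRingAt O) S.RatFun d)
      (div_ne_zero hgK hdK) (fun C hC hCO ↦ by
        have h1 := Scheme.ord_mul (x := C) (div_ne_zero hgK hdK) hdK
        rw [div_mul_cancel₀ _ hdK, hZ C hC hCO] at h1
        linarith [hgZ C hC hCO])
    refine Ideal.mem_span_singleton'.mpr ⟨c, ?_⟩
    refine IsFractionRing.injective (S.LocalRingAt O) S.RatFun ?_
    rw [map_mul, hc, div_mul_cancel₀ _ hdK]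
  · rw [Ideal.span_singleton_le_iff_mem]
    exact Ideal.subset_span ⟨hd, fun C hC hCO ↦ (hZ C hC hCO).ge⟩

theorem WeilDivisor.exists_ord_algebraMap_eq (O : S.carrier)
    [UniqueFactorizationMonoid (S.LocalRingAt O)] {R : S.WeilDivisor} (hR : R.IsEffective) :
    ∃ r : S.LocalRingAt O, r ≠ 0 ∧ ∀ C : S.carrier, Order.coheight C = 1 → C ⤳ O →
      Scheme.ord (algebraMap (S.LocalRingAt O) S.RatFun r) C = R.cycle C := by
  obtain ⟨f, hf, hfR⟩ := Scheme.exists_ord_eq (O := O) R.cycle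
  obtain ⟨r, rfl⟩ := Scheme.exists_algebraMap_eq_of_ord_nonneg (O := O) hf
    fun C hC hCO ↦ (hR C).trans (hfR C hC hCO).ge
  exact ⟨r, fun h ↦ hf (by rw [h, map_zero]), hfR⟩

/-- Local equations at `O` of the members of a linear system, depending linearly on the member. -/
theorem LinearSystem.exists_localEquation (𝒟 : S.LinearSystem) (O : S.carrier)
    [UniqueFactorizationMonoid (S.LocalRingAt O)] :
    ∃ s : 𝒟.V →ₗ[ℂ] S.LocalRingAt O, Function.Injective s ∧ ∀ f, f ≠ 0 →
      ∀ C : S.carrier, Order.coheight C = 1 → C ⤳ O →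
        Scheme.ord (algebraMap (S.LocalRingAt O) S.RatFun (s f)) C = 𝒟.member f C := by
  -- The base divisor need not be effective, so `b` is only a rational function; effectivity of the
  -- members makes each `f * b` regular at `O`.
  obtain ⟨b, hb, hbB⟩ := Scheme.exists_ord_eq (O := O) 𝒟.base.cycle
  have hord (f : 𝒟.V) (hf : f ≠ 0) (C : S.carrier) (hC : Order.coheight C = 1) (hCO : C ⤳ O) :
      Scheme.ord ((f : S.RatFun) * b) C = 𝒟.member f C := by
    rw [Scheme.ord_mul (by simpa using hf) hb, hbB C hC hCO]
    rfl
  let ι : S.LocalRingAt O →ₗ[ℂ] S.RatFun :=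
    (IsScalarTower.toAlgHom ℂ (S.LocalRingAt O) S.RatFun).toLinearMap
  have hι : Function.Injective ι := IsFractionRing.injective (S.LocalRingAt O) S.RatFun
  let μ : 𝒟.V →ₗ[ℂ] S.RatFun := LinearMap.mulRight ℂ b ∘ₗ 𝒟.V.subtype
  have hμ (f : 𝒟.V) : μ f ∈ LinearMap.range ι := by
    by_cases hf : f = 0
    · rw [hf, map_zero]
      exact Submodule.zero_mem _
    · exact Scheme.exists_algebraMap_eq_of_ord_nonneg (O := O)
        (mul_ne_zero (by simpa using hf) hb) fun C hC hCO ↦ by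
          exact (𝒟.effective f f.2 (by simpa using hf) C).trans (hord f hf C hC hCO).ge
  let s : 𝒟.V →ₗ[ℂ] S.LocalRingAt O :=
    (LinearEquiv.ofInjective ι hι).symm.toLinearMap ∘ₗ μ.codRestrict (LinearMap.range ι) hμ
  have hs (f : 𝒟.V) : algebraMap (S.LocalRingAt O) S.RatFun (s f) = f * b :=
    congrArg Subtype.val ((LinearEquiv.ofInjective ι hι).apply_symm_apply ⟨μ f, hμ f⟩)
  refine ⟨s, ?_, fun f hf C hC hCO ↦ by rw [hs, hord f hf C hC hCO]⟩
  rw [injective_iff_map_eq_zero]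
  intro f hf
  have := hs f
  rw [hf, map_zero, eq_comm, mul_eq_zero_iff_right hb] at this
  exact Subtype.ext this

end NormalSurface

end

/-! ### The comparison on the surface -/

theorem lemma2p1 (S : NormalSurface) (O : S.carrier) (hO : S.IsSmoothPoint O)
    (R : S.WeilDivisor) (hR : R.IsEffective)
    (𝒟 : S.LinearSystem) (h𝒟 : 𝒟.HasNoFixedComponents) :
    𝒟.ForGeneralMembers fun D₁ D₂ =>
      NormalSurface.intersectionMultAt O D₁ R.cycle ≠ ⊤ ∧
      NormalSurface.intersectionMultAt O D₁ D₂ ≠ ⊤ ∧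
      NormalSurface.intersectionMultAt O D₁ R.cycle =
        NormalSurface.intersectionMultAt O D₂ R.cycle ∧
      NormalSurface.intersectionMultAt O D₁ R.cycle ≤
        NormalSurface.multAt O R.cycle * NormalSurface.intersectionMultAt O D₁ D₂ := by
  have := hO.regular
  have hdim := NormalSurface.ringKrullDim_localRingAt_le O
  have : UniqueFactorizationMonoid (S.LocalRingAt O) :=
    IsRegularLocalRing.uniqueFactorizationMonoid hdim
  obtain ⟨x, y, hxy⟩ := IsRegularLocalRing.exists_maximalIdeal_eq_span_pair hdim
  obtain ⟨r, hr0, hr⟩ := NormalSurface.WeilDivisor.exists_ord_algebraMap_eq O hR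
  obtain ⟨s, hsinj, hs⟩ := 𝒟.exists_localEquation O
  have hsne (f : 𝒟.V) (hf : f ≠ 0) : s f ≠ 0 := (map_ne_zero_iff s hsinj).mpr hf
  have hRr : NormalSurface.idealAt O R.cycle = Ideal.span {r} :=
    NormalSurface.idealAt_eq_span hr0 hr
  have hDs (f : 𝒟.V) (hf : f ≠ 0) : NormalSurface.idealAt O (𝒟.member f) = Ideal.span {s f} :=
    NormalSurface.idealAt_eq_span (hsne f hf) (hs f hf)
  have hne : ∃ f, s f ≠ 0 := by
    obtain ⟨f, hfV, hf⟩ := Submodule.exists_mem_ne_zero_of_ne_bot 𝒟.ne_bot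
    exact ⟨⟨f, hfV⟩, hsne _ (by simpa using hf)⟩
  -- A common prime factor of the local equations would define a fixed component through `O`.
  have hfix (π : S.LocalRingAt O) (hπ : Prime π) : ∃ f, ¬ π ∣ s f := by
    obtain ⟨C, hCO, hC, hp⟩ := Scheme.exists_primeAt_eq_span_of_prime hπ
    obtain ⟨f, hf, hfC⟩ := h𝒟 C hC
    refine ⟨f, fun hdvd ↦ ?_⟩
    have h1 := Scheme.one_le_ord_algebraMap hCO hC hp (hsne f hf) hdvd
    have h2 := hs f hf C hC hCO
    rw [hfC] at h2
    exact absurd (h2 ▸ h1) (by norm_num)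
  refine (IsLocalRing.holdsGenerally_length_quotient
    (NormalSurface.exists_sub_algebraMap_mem_maximalIdeal hO.isClosed) hxy s hne hfix hr0
    (M := NormalSurface.multAt O R.cycle) fun n hn ↦ ?_).mono ?_
  · refine le_iSup₂_of_le n ?_ le_rfl
    change NormalSurface.idealAt O R.cycle ≤ _
    rwa [hRr, Ideal.span_singleton_le_iff_mem]
  · rintro ⟨f₁, f₂⟩ ⟨h₁, h₂, h⟩
    have hf₁ : f₁ ≠ 0 := fun h0 ↦ h₁ (by simp [h0])
    have hf₂ : f₂ ≠ 0 := fun h0 ↦ h₂ (by simp [h0])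
    refine ⟨hf₁, hf₂, ?_⟩
    simp only [NormalSurface.intersectionMultAt]
    rw [hRr, hDs f₁ hf₁, hDs f₂ hf₂]
    exact h
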